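/- **Setting.** Let $K\subset\Sigma\subset M$ be a triple in which $M$ is a compact 3-manifold, $\Sigma\subset M$ is a compact surface with boundary, and $\partial\Sigma=K$. A point $x\in M$ has $\dim(x)=1$ if $x\in K$, $\dim(x)=2$ if $x\in\Sigma\setminus K$, and $\dim(x)=3$ if $x\in M\setminus\Sigma$. Let $\mathsf 3$ be the chain $1<2<3$. A finite $\mathsf 3$-parcel is a category $\mathcal C$ with finite hom-sets and a conservative functor $U:\mathcal C\to\mathsf 3$ that is bijective on objects; write $G_i=\mathcal C(i,i)$. Let $\mathcal T$ be a finite triangulation of $M$ in which $K$ and $\Sigma$ are subcomplexes and which is flag-like: each of $K$, $\Sigma$ meets every simplex in a face or in the empty set. Let $\mathcal C(\mathcal T)$ be the category generated by an arrow $(v,w):v\to w$ for every ordered pair of vertices joined by an edge of $\mathcal T$ with $\dim v\le\dim w$, subject to $(v,w)(w,v)=\mathrm{Id}_v$ whenever both arrows exist and $(v,w)(w,x)=(v,x)$ whenever $v,w,x$ span a 2-simplex; it has a functor to $\mathsf 3$ given on objects by $\dim$. Let $[\mathcal T,\mathcal C]$ be the set of functors $\mathcal C(\mathcal T)\to\mathcal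 C$ that commute with the functors to $\mathsf 3$, let $\mathcal T_0^i$ be the set of vertices of dimension $i$, and define the untwisted invariant $$I_{\mathcal C}(\mathcal T)=\frac{\#[\mathcal T,\mathcal C]}{\prod_{i=1}^3(\#G_i)^{\#\mathcal T_0^i}}.$$ Give $M$ the $d$-space structure (in the sense of Grandis) whose directed paths are the continuous paths $p:[0,1]\to M$ along which $\dim(p(t))$ is non-decreasing. Its fundamental category $\uparrow\!\Pi_1(M)$ has the points of $M$ as objects and, as arrows, directed paths modulo the equivalence relation generated by directed homotopies (i.e. $d$-maps $\uparrow\![0,1]\times\uparrow\![0,1]\to M$) with fixed end points. **Theorem.** There is a functor $D:\uparrow\!\Pi_1(M)\to\mathsf 3$ given on objects by $x\mapsto\dim(x)$. For every flag-like triangulation $\mathcal T$, every finite $\mathsf 3$-parcel $\mathcal C$ and every skeleton $\uparrow\!\pi_1$ of $\uparrow\!\Pi_1(M)$, the skeleton has finitely many objects, there are finitely many functors $\uparrow\!\pi_1\to\mathcal C$ commuting with the functors to $\mathsf 3$, and the untwisted invariant is the (normalised) count of these functors: $$I_{\mathcal C}(\mathcal T)=\frac{\#\{F:\uparrow\!\pi_1\to\mathcal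 C \text{ a functor over } \mathsf 3\}}{\prod_{i=1}^3(\#G_i)^{c_i}},$$ where $c_i$ is the number of objects of $\uparrow\!\pi_1$ of dimension $i$. -/

import Mathlib

open CategoryTheory Topology
open scoped unitInterval

noncomputable section

/-! ## Directed spaces and the fundamental category -/

/-- A `d`-space in the sense of Grandis: a topological space with a distinguished class of directed
paths, which contains the constant paths and is closed under monotone (possibly partial)
reparametrisation and under concatenation. -/
structure DSpace (X : Type*) [TopologicalSpace X] where
  IsDirected : C(I, X) → Prop
  const : ∀ x : X, IsDirected (ContinuousMap.const I x)
  reparam : ∀ (p : C(I, X)) (h : C(I, I)), Monotone h → IsDirected p → IsDirected (p.comp h)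
  trans : ∀ {x y z : X} (p : Path x y) (q : Path y z),
    IsDirected p.toContinuousMap → IsDirected q.toContinuousMap →
      IsDirected (p.trans q).toContinuousMap

namespace DSpace

/-- The `d`-space structure given by a function `d` to a preorder: directed paths are the continuous
paths along which `d` is non-decreasing, i.e. the paths which are monotone for the preorder
`x ≼ y ↔ d x ≤ d y`. -/
def ofFun {X : Type*} [TopologicalSpace X] {P : Type*} [Preorder P] (d : X → P) : DSpace X where
  IsDirected p := Monotone fun t => d (p t)
  const _ := fun _ _ _ => le_rfl
  reparam _ _ hh hp := hp.comp hh
  trans {x y z} p q hp hq := by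
    have hp' : ∀ s t : I, s ≤ t → d (p s) ≤ d (p t) := fun s t h => hp h
    have hq' : ∀ s t : I, s ≤ t → d (q s) ≤ d (q t) := fun s t h => hq h
    intro s t hst
    have hst' : (s : ℝ) ≤ t := hst
    change d ((p.trans q) s) ≤ d ((p.trans q) t)
    rw [Path.trans_apply, Path.trans_apply]
    split_ifs with h1 h2 h2
    · exact hp' _ _ (Subtype.mk_le_mk.2 (by linarith))
    · refine (hp' _ 1 unitInterval.le_one').trans ?_
      rw [p.target]
      have h0 := hq' 0 ⟨2 * (t : ℝ) - 1, unitInterval.two_mul_sub_one_mem_iff.2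
        ⟨(not_le.1 h2).le, t.2.2⟩⟩ unitInterval.nonneg'
      rwa [q.source] at h0
    · exact absurd (hst'.trans h2) h1
    · exact hq' _ _ (Subtype.mk_le_mk.2 (by linarith))

variable {X : Type*} [TopologicalSpace X] (D : DSpace X)

/-- A continuous map `↑I × ↑I → X` is directed if it is a `d`-map, i.e. if it carries directed paths
of the product `↑I × ↑I` (the paths both of whose components are monotone) to directed paths. -/
def IsDirectedSquare (φ : C(I × I, X)) : Prop :=
  ∀ γ : C(I, I × I), Monotone γ → D.IsDirected (φ.comp γ)

/-- Directed paths from `x` to `y`. -/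
def DPath (x y : X) : Type _ := {p : Path x y // D.IsDirected p.toContinuousMap}

/-- There is a directed homotopy with fixed end points from `p` to `q`. -/
def DHomotopyRel {x y : X} (p q : D.DPath x y) : Prop :=
  ∃ H : Path.Homotopy p.1 q.1, D.IsDirectedSquare H.toContinuousMap

/-- Directed paths up to the equivalence relation generated by directed homotopy with fixed end
points (`Quot` generates the equivalence relation). -/
def Arrow (x y : X) : Type _ := Quot (D.DHomotopyRel (x := x) (y := y))

/-- The constant path. -/
def DPath.refl (x : X) : D.DPath x x := ⟨Path.refl x, D.const x⟩

variable {D} in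
/-- Concatenation of directed paths. -/
def DPath.trans {x y z : X} (p : D.DPath x y) (q : D.DPath y z) : D.DPath x z :=
  ⟨p.1.trans q.1, D.trans _ _ p.2 q.2⟩

/-- A path which is directed before and after a time `u₀` is directed. -/
theorem isDirected_glue (c : C(I, X)) (u₀ : I) (a b : C(I, I))
    (ha : ∀ u : I, (a u : ℝ) = u₀ * u) (hb : ∀ u : I, (b u : ℝ) = u₀ + (1 - u₀) * u)
    (hca : D.IsDirected (c.comp a)) (hcb : D.IsDirected (c.comp b)) : D.IsDirected c := by
  rcases eq_or_lt_of_le (unitInterval.nonneg u₀) with h0 | h0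
  · convert hcb using 1
    ext u
    exact congrArg c (Subtype.ext (by simp [hb, ← h0]))
  rcases eq_or_lt_of_le (unitInterval.le_one u₀) with h1 | h1
  · convert hca using 1
    ext u
    exact congrArg c (Subtype.ext (by simp [ha, h1]))
  have h1' : (0 : ℝ) < 1 - u₀ := by linarith
  have ha1 : a 1 = u₀ := Subtype.ext (by simp [ha])
  have hb0 : b 0 = u₀ := Subtype.ext (by simp [hb])
  let p : Path (c (a 0)) (c u₀) := ⟨c.comp a, rfl, by simp [ha1]⟩
  let q : Path (c u₀) (c (b 1)) := ⟨c.comp b, by simp [hb0], rfl⟩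
  have hpq := D.trans p q hca hcb
  have key : ∀ v : I, min (v : ℝ) u₀ / (2 * u₀) + max ((v : ℝ) - u₀) 0 / (2 * (1 - u₀)) ∈ I := by
    intro v
    have hv0 := unitInterval.nonneg v
    have hv1 := unitInterval.le_one v
    have e1 : min (v : ℝ) u₀ / (2 * u₀) ≤ 1 / 2 := by
      rw [div_le_div_iff₀ (by positivity) (by positivity)]
      nlinarith [min_le_right (v : ℝ) u₀]
    have e2 : max ((v : ℝ) - u₀) 0 / (2 * (1 - u₀)) ≤ 1 / 2 := by
      rw [div_le_div_iff₀ (by positivity) (by positivity)]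
      have : max ((v : ℝ) - u₀) 0 ≤ 1 - u₀ := max_le (by linarith) h1'.le
      linarith
    exact ⟨by positivity, by linarith⟩
  let h : C(I, I) := ⟨fun v => ⟨_, key v⟩, by fun_prop⟩
  have hh : Monotone h := by
    intro v w hvw
    have hvw' : (v : ℝ) ≤ w := hvw
    apply Subtype.mk_le_mk.2
    have := min_le_min_right (u₀ : ℝ) hvw'
    have := max_le_max_right (0 : ℝ) (sub_le_sub_right hvw' (u₀ : ℝ))
    gcongr
  convert D.reparam _ h hh hpq using 1
  ext v
  change c v = (p.trans q) (h v)
  have hv : ((h v : I) : ℝ) =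
      min (v : ℝ) u₀ / (2 * u₀) + max ((v : ℝ) - u₀) 0 / (2 * (1 - u₀)) := rfl
  rw [Path.trans_apply]
  rcases le_or_gt (v : ℝ) u₀ with hvu | hvu
  · rw [min_eq_left hvu, max_eq_right (by linarith), zero_div, add_zero] at hv
    have hle : ((h v : I) : ℝ) ≤ 1 / 2 := by
      rw [hv, div_le_div_iff₀ (by positivity) (by positivity)]; linarith
    rw [dif_pos hle]
    refine congrArg c (Subtype.ext ?_)
    rw [ha]
    simp only [hv]
    field_simp
  · rw [min_eq_right hvu.le, max_eq_left (by linarith)] at hv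
    have hlt : ¬ ((h v : I) : ℝ) ≤ 1 / 2 := by
      have e1 : (u₀ : ℝ) / (2 * u₀) = 1 / 2 := by field_simp
      have e2 : 0 < ((v : ℝ) - u₀) / (2 * (1 - u₀)) := div_pos (by linarith) (by positivity)
      rw [hv, e1]; linarith
    rw [dif_neg hlt]
    refine congrArg c (Subtype.ext ?_)
    rw [hb]
    simp only [hv]
    field_simp
    ring

/-- Directed homotopies can be concatenated horizontally. -/
theorem DHomotopyRel.hcomp {x y z : X} {p p' : D.DPath x y} {q q' : D.DPath y z}
    (hp : D.DHomotopyRel p p') (hq : D.DHomotopyRel q q') :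
    D.DHomotopyRel (p.trans q) (p'.trans q') := by
  obtain ⟨F, hF⟩ := hp
  obtain ⟨G, hG⟩ := hq
  refine ⟨F.hcomp G, ?_⟩
  have low : ∀ γ : C(I, I × I), Monotone γ → (∀ u, ((γ u).2 : ℝ) ≤ 1 / 2) →
      D.IsDirected ((F.hcomp G).toContinuousMap.comp γ) := by
    intro γ hγ hle
    let γ' : C(I, I × I) := ⟨fun u => ((γ u).1, ⟨2 * (γ u).2,
      (unitInterval.mul_pos_mem_iff zero_lt_two).2 ⟨unitInterval.nonneg _, hle u⟩⟩), by fun_prop⟩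
    have hγ' : Monotone γ' := fun u v huv => ⟨(hγ huv).1, Subtype.mk_le_mk.2 (by
      have : ((γ u).2 : ℝ) ≤ (γ v).2 := (hγ huv).2
      linarith)⟩
    convert hF γ' hγ' using 1
    ext u
    change (F.hcomp G) (γ u) = _
    rw [Path.Homotopy.hcomp_apply, dif_pos (hle u)]
    rfl
  have high : ∀ γ : C(I, I × I), Monotone γ → (∀ u, 1 / 2 ≤ ((γ u).2 : ℝ)) →
      D.IsDirected ((F.hcomp G).toContinuousMap.comp γ) := by
    intro γ hγ hle
    let γ' : C(I, I × I) := ⟨fun u => ((γ u).1, ⟨2 * (γ u).2 - 1,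
      unitInterval.two_mul_sub_one_mem_iff.2 ⟨hle u, unitInterval.le_one _⟩⟩), by fun_prop⟩
    have hγ' : Monotone γ' := fun u v huv => ⟨(hγ huv).1, Subtype.mk_le_mk.2 (by
      have : ((γ u).2 : ℝ) ≤ (γ v).2 := (hγ huv).2
      linarith)⟩
    convert hG γ' hγ' using 1
    ext u
    change (F.hcomp G) (γ u) = G (γ' u)
    rw [Path.Homotopy.hcomp_apply]
    split_ifs with h
    · have hh : ((γ u).2 : ℝ) = 1 / 2 := le_antisymm h (hle u)
      have e1 : (⟨2 * ((γ u).2 : ℝ), (unitInterval.mul_pos_mem_iff zero_lt_two).2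
          ⟨(γ u).2.2.1, h⟩⟩ : I) = 1 := Subtype.ext (by simp [hh])
      have e2 : γ' u = ((γ u).1, 0) := Prod.ext rfl (Subtype.ext (by simp [γ', hh]))
      rw [e1, e2]
      simp
    · rfl
  intro γ hγ
  by_cases h1 : ∀ u, ((γ u).2 : ℝ) ≤ 1 / 2
  · exact low γ hγ h1
  by_cases h2 : ∀ u, 1 / 2 ≤ ((γ u).2 : ℝ)
  · exact high γ hγ h2
  push Not at h1 h2
  obtain ⟨u1, hu1⟩ := h1
  obtain ⟨u2, hu2⟩ := h2
  obtain ⟨u₀, -, hu₀⟩ := isPreconnected_univ.intermediate_value (Set.mem_univ u2)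
    (Set.mem_univ u1) (f := fun u => ((γ u).2 : ℝ)) (by fun_prop)
    (show (1 / 2 : ℝ) ∈ _ from ⟨hu2.le, hu1.le⟩)
  have hu₀0 := unitInterval.nonneg u₀
  have hu₀1 := unitInterval.le_one u₀
  let a : C(I, I) := ⟨fun u => u₀ * u, by fun_prop⟩
  let b : C(I, I) := ⟨fun u => ⟨u₀ + (1 - u₀) * u, by
    have := unitInterval.nonneg u
    have := unitInterval.le_one u
    exact ⟨by nlinarith, by nlinarith⟩⟩, by fun_prop⟩
  have ha : Monotone a := fun u v huv => mul_le_mul_right huv u₀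
  have hb : Monotone b := fun u v huv => Subtype.mk_le_mk.2 (by
    have : (u : ℝ) ≤ v := huv
    nlinarith)
  refine D.isDirected_glue _ u₀ a b (fun u => rfl) (fun u => rfl) ?_ ?_
  · refine low (γ.comp a) (hγ.comp ha) fun u => ?_
    have hle : a u ≤ u₀ := by
      apply Subtype.coe_le_coe.1
      change (u₀ : ℝ) * u ≤ u₀
      nlinarith [unitInterval.le_one u]
    have : ((γ (a u)).2 : ℝ) ≤ (γ u₀).2 := (hγ hle).2
    exact this.trans hu₀.le
  · refine high (γ.comp b) (hγ.comp hb) fun u => ?_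
    have hle : u₀ ≤ b u := by
      apply Subtype.coe_le_coe.1
      change (u₀ : ℝ) ≤ u₀ + (1 - u₀) * u
      nlinarith [unitInterval.nonneg u]
    have : ((γ u₀).2 : ℝ) ≤ (γ (b u)).2 := (hγ hle).2
    exact hu₀.ge.trans this

/-- The constant homotopy of a directed path is directed. -/
theorem DHomotopyRel.refl {x y : X} (p : D.DPath x y) : D.DHomotopyRel p p :=
  ⟨Path.Homotopy.refl p.1, fun γ hγ =>
    D.reparam _ ⟨fun u => (γ u).2, by fun_prop⟩ (fun _ _ h => (hγ h).2) p.2⟩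

/-- If `k₀ ≤ k₁` are monotone reparametrisations of `[0,1]`, then there is a directed homotopy from
`p ∘ k₀` to `p ∘ k₁`. -/
theorem dHomotopyRel_reparam {x y : X} (p q r : D.DPath x y) (k₀ k₁ : C(I, I))
    (hk₀ : Monotone k₀) (hk₁ : Monotone k₁) (hk₀k₁ : ∀ t, k₀ t ≤ k₁ t)
    (hk₀0 : k₀ 0 = 0) (hk₀1 : k₀ 1 = 1) (hk₁0 : k₁ 0 = 0) (hk₁1 : k₁ 1 = 1)
    (hq : ∀ t, q.1 t = p.1 (k₀ t)) (hr : ∀ t, r.1 t = p.1 (k₁ t)) : D.DHomotopyRel q r := by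
  have mem : ∀ s t : I, (1 - (s : ℝ)) * k₀ t + s * k₁ t ∈ I := fun s t => by
    have h1 := unitInterval.nonneg s
    have h2 := unitInterval.le_one s
    have h3 := unitInterval.nonneg (k₀ t)
    have h4 := unitInterval.le_one (k₀ t)
    have h5 := unitInterval.nonneg (k₁ t)
    have h6 := unitInterval.le_one (k₁ t)
    exact ⟨by nlinarith, by nlinarith⟩
  let k : C(I × I, I) := ⟨fun x => ⟨_, mem x.1 x.2⟩, by fun_prop⟩
  have hk : Monotone k := by
    intro u v huv
    apply Subtype.mk_le_mk.2
    have h1 : (u.1 : ℝ) ≤ v.1 := huv.1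
    have h2 : (k₀ u.2 : ℝ) ≤ k₀ v.2 := hk₀ huv.2
    have h3 : (k₁ u.2 : ℝ) ≤ k₁ v.2 := hk₁ huv.2
    have h4 : (k₀ v.2 : ℝ) ≤ k₁ v.2 := hk₀k₁ v.2
    have h5 := unitInterval.nonneg u.1
    have h6 := unitInterval.le_one u.1
    nlinarith [mul_nonneg (sub_nonneg.2 h1) (sub_nonneg.2 h4),
      mul_nonneg (sub_nonneg.2 h6) (sub_nonneg.2 h2), mul_nonneg h5 (sub_nonneg.2 h3)]
  refine ⟨⟨⟨p.1.toContinuousMap.comp k, fun t => ?_, fun t => ?_⟩, fun s t ht => ?_⟩,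
    fun γ hγ => D.reparam _ (k.comp γ) (hk.comp hγ) p.2⟩
  · change p.1 (k (0, t)) = q.1 t
    rw [hq]
    exact congrArg p.1 (Subtype.ext (by simp [k]))
  · change p.1 (k (1, t)) = r.1 t
    rw [hr]
    exact congrArg p.1 (Subtype.ext (by simp [k]))
  · change p.1 (k (s, t)) = q.1 t
    rw [hq]
    refine congrArg p.1 (Subtype.ext ?_)
    rcases ht with rfl | ht
    · simp [k, hk₀0, hk₁0]
    · rw [Set.mem_singleton_iff] at ht
      subst ht
      simp [k, hk₀1, hk₁1]

/-- The underlying points of a `d`-space, as objects of its fundamental category. -/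
structure FundamentalCategory (D : DSpace X) where
  pt : X

/-- The fundamental category `↑Π₁` of a `d`-space: objects are points, arrows are classes of
directed paths, and `f ≫ g` is the concatenation "first `f`, then `g`". -/
instance : Category D.FundamentalCategory where
  Hom x y := D.Arrow x.pt y.pt
  id x := Quot.mk _ (DPath.refl D x.pt)
  comp := Quot.map₂ DPath.trans (fun p _ _ h => DHomotopyRel.hcomp D (.refl D p) h)
    (fun _ _ q h => DHomotopyRel.hcomp D h (.refl D q))
  id_comp {x y} f := by
    induction f using Quot.inductionOn with | _ p
    have mem : ∀ t : I, max 0 (2 * (t : ℝ) - 1) ∈ I := fun t =>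
      ⟨le_max_left _ _, max_le zero_le_one (by linarith [unitInterval.le_one t])⟩
    refine Quot.sound (D.dHomotopyRel_reparam p ((DPath.refl D x.pt).trans p) p
      ⟨fun t => ⟨_, mem t⟩, by fun_prop⟩ (.id I) (fun s t h => ?_) monotone_id (fun t => ?_)
      (Subtype.ext (by simp)) (Subtype.ext (by norm_num)) rfl rfl (fun t => ?_) (fun t => rfl))
    · have h' : (s : ℝ) ≤ t := h
      exact Subtype.mk_le_mk.2 (max_le_max_left _ (by linarith))
    · exact Subtype.coe_le_coe.1
        (max_le (unitInterval.nonneg t) (by simpa using by linarith [unitInterval.le_one t]))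
    · change ((Path.refl x.pt).trans p.1) t = _
      rw [Path.trans_apply]
      split_ifs with h
      · exact p.1.source.symm.trans
          (congrArg p.1 (Subtype.ext (max_eq_left (show 2 * (t : ℝ) - 1 ≤ 0 by linarith)).symm))
      · exact congrArg p.1 (Subtype.ext (max_eq_right (by linarith)).symm)
  comp_id {x y} f := by
    induction f using Quot.inductionOn with | _ p
    have mem : ∀ t : I, min 1 (2 * (t : ℝ)) ∈ I := fun t =>
      ⟨le_min zero_le_one (by linarith [unitInterval.nonneg t]), min_le_left _ _⟩
    refine (Quot.sound (D.dHomotopyRel_reparam p p (p.trans (DPath.refl D y.pt))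
      (.id I) ⟨fun t => ⟨_, mem t⟩, by fun_prop⟩ monotone_id (fun s t h => ?_) (fun t => ?_)
      rfl rfl (Subtype.ext (by simp)) (Subtype.ext (by norm_num)) (fun t => rfl)
      (fun t => ?_))).symm
    · have h' : (s : ℝ) ≤ t := h
      exact Subtype.mk_le_mk.2 (min_le_min_left _ (by linarith))
    · exact Subtype.coe_le_coe.1
        (le_min (unitInterval.le_one t) (by simpa using by linarith [unitInterval.nonneg t]))
    · change (p.1.trans (Path.refl y.pt)) t = _
      rw [Path.trans_apply]
      split_ifs with h
      · exact congrArg p.1 (Subtype.ext (min_eq_right (by linarith)).symm)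
      · exact p.1.target.symm.trans
          (congrArg p.1 (Subtype.ext (min_eq_left (show (1 : ℝ) ≤ 2 * t by linarith)).symm))
  assoc {w x y z} f g h := by
    induction f using Quot.inductionOn with | _ p
    induction g using Quot.inductionOn with | _ q
    induction h using Quot.inductionOn with | _ r
    refine (Quot.sound (D.dHomotopyRel_reparam (p.trans (q.trans r)) (p.trans (q.trans r))
      ((p.trans q).trans r) (.id I)
      ⟨fun t => ⟨_, Path.Homotopy.transAssocReparamAux_mem_I t⟩, by fun_prop⟩
      monotone_id (fun s t h => ?_) (fun t => ?_)
      rfl rfl (Subtype.ext Path.Homotopy.transAssocReparamAux_zero)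
      (Subtype.ext Path.Homotopy.transAssocReparamAux_one) (fun t => rfl)
      (fun t => ?_))).symm
    · have h' : (s : ℝ) ≤ t := h
      refine Subtype.mk_le_mk.2 ?_
      unfold Path.Homotopy.transAssocReparamAux
      split_ifs <;> linarith
    · refine Subtype.coe_le_coe.1 ?_
      change (t : ℝ) ≤ Path.Homotopy.transAssocReparamAux t
      have := unitInterval.nonneg t
      have := unitInterval.le_one t
      unfold Path.Homotopy.transAssocReparamAux
      split_ifs <;> linarith
    · change ((p.1.trans q.1).trans r.1) t = _
      rw [Path.Homotopy.trans_assoc_reparam]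
      rfl

end DSpace

/-! ## Parcels -/

/-- The three-element chain `1 < 2 < 3`, regarded as a category through its order. -/
abbrev Three : Type := Set.Icc (1 : ℕ) 3

/-- A `P`-parcel structure on a category `C`: a conservative functor to the poset `P` which is
bijective on objects. -/
structure Parcel (P : Type*) [PartialOrder P] (C : Type*) [Category C] where
  U : C ⥤ P
  bijective : Function.Bijective U.obj
  conservative : U.ReflectsIsomorphisms

namespace Parcel

variable {P : Type*} [PartialOrder P] {C : Type*} [Category C] (𝒞 : Parcel P C)

/-- The object of the parcel lying over `i`. -/
def obj (i : P) : C := (Equiv.ofBijective 𝒞.U.obj 𝒞.bijective).symm i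

/-- The order of the endomorphism group `G_i = C(i, i)`. -/
def groupOrder (i : P) : ℕ := Nat.card (𝒞.obj i ⟶ 𝒞.obj i)

end Parcel

/-! ## Knot, Seifert surface, 3-manifold triples and their flag-like triangulations -/

/-- A triple `K ⊂ Σ ⊂ M`: `M` is a 3-manifold (possibly with boundary) and `Σ ⊂ M` is a surface
with boundary `K`. -/
structure KnotSurfaceTriple (M : Type*) [TopologicalSpace M] where
  knot : Set M
  surface : Set M
  knot_subset : knot ⊆ surface
  manifold_chart : ∀ x : M, ∃ e : OpenPartialHomeomorph M (EuclideanHalfSpace 3), x ∈ e.source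
  surface_chart : ∀ x : surface, ∃ e : OpenPartialHomeomorph surface (EuclideanHalfSpace 2),
    x ∈ e.source ∧ ∀ y ∈ e.source, (y : M) ∈ knot ↔ (e y).1 0 = 0

namespace KnotSurfaceTriple

variable {M : Type*} [TopologicalSpace M] (X : KnotSurfaceTriple M)

open Classical in
/-- The dimension of the stratum (`K`, `Σ ∖ K` or `M ∖ Σ`) in which a point lies. -/
def dim (x : M) : Three :=
  if x ∈ X.knot then ⟨1, by simp⟩ else if x ∈ X.surface then ⟨2, by simp⟩ else ⟨3, by simp⟩

/-- The `d`-space structure on `M` whose directed paths are those along which the dimension of the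
stratum does not decrease. -/
def dSpace : DSpace M := DSpace.ofFun X.dim

end KnotSurfaceTriple

namespace AbstractSimplicialComplex

variable {V : Type*} [Fintype V]

/-- The support of a point given by barycentric coordinates. -/
def support (x : V → ℝ) : Finset V := Finset.univ.filter fun v => x v ≠ 0

/-- The geometric realisation of a finite simplicial complex, by barycentric coordinates. -/
def realization (T : AbstractSimplicialComplex V) : Set (V → ℝ) :=
  {x | (∀ v, 0 ≤ x v) ∧ ∑ v, x v = 1 ∧ support x ∈ T.faces}

open Classical in
/-- A vertex, as a point of the geometric realisation. -/
def vertex (T : AbstractSimplicialComplex V) (v : V) : T.realization :=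
  ⟨Pi.single v 1, fun w => by by_cases h : w = v <;> simp [h], by simp, by
    have : support (Pi.single v 1 : V → ℝ) = {v} := by
      ext w
      by_cases h : w = v <;> simp [support, h]
    rw [this]
    exact T.singleton_mem v⟩

/-- The closed simplex of the geometric realisation spanned by a set of vertices (it is empty if
the set is empty). -/
def closedSimplex (T : AbstractSimplicialComplex V) (s : Finset V) : Set T.realization :=
  {x | support x.1 ⊆ s}

end AbstractSimplicialComplex

/-- A finite triangulation, with set of vertices `V`, of a triple `K ⊂ Σ ⊂ M`, such that `K` and `Σ`
are subcomplexes, which is flag-like: the intersection of each of `K` and `Σ` with each simplex is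
either empty or a face of that simplex. -/
structure FlagLikeTriangulation {M : Type*} [TopologicalSpace M] (X : KnotSurfaceTriple M)
    (V : Type*) [Fintype V] where
  complex : AbstractSimplicialComplex V
  homeo : complex.realization ≃ₜ M
  knot_subcomplex : ∃ L ⊆ complex.faces, homeo ⁻¹' X.knot = ⋃ s ∈ L, complex.closedSimplex s
  surface_subcomplex : ∃ L ⊆ complex.faces, homeo ⁻¹' X.surface = ⋃ s ∈ L, complex.closedSimplex s
  knot_flag : ∀ s ∈ complex.faces, ∃ t ⊆ s,
    homeo ⁻¹' X.knot ∩ complex.closedSimplex s = complex.closedSimplex t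
  surface_flag : ∀ s ∈ complex.faces, ∃ t ⊆ s,
    homeo ⁻¹' X.surface ∩ complex.closedSimplex s = complex.closedSimplex t

namespace FlagLikeTriangulation

variable {M : Type*} [TopologicalSpace M] {X : KnotSurfaceTriple M} {V : Type*} [Fintype V]
  [DecidableEq V] (T : FlagLikeTriangulation X V)

/-- The dimension of the stratum in which a vertex lies. -/
def vdim (v : V) : Three := X.dim (T.homeo (T.complex.vertex v))

/-- The vertices of the directed graph `Γ(T)`. -/
structure Graph (T : FlagLikeTriangulation X V) where
  vertex : V

/-- The directed graph `Γ(T)`: there is an edge `(v, w)` whenever `v` and `w` are connected by an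
edge of `T` and `dim v ≤ dim w`. -/
instance : Quiver.{0} T.Graph where
  Hom v w := PLift (v.vertex ≠ w.vertex ∧ {v.vertex, w.vertex} ∈ T.complex.faces ∧
    T.vdim v.vertex ≤ T.vdim w.vertex)

/-- The relations `(v,w)(w,v) = Id_v`, whenever there are edges in both directions, and
`(v,w)(w,x) = (v,x)`, whenever `v, w, x` are the vertices of a 2-simplex. -/
inductive Rel : HomRel (Paths T.Graph)
  | inv {v w : T.Graph} (e : v ⟶ w) (f : w ⟶ v) :
      Rel ((Paths.of T.Graph).map e ≫ (Paths.of T.Graph).map f) (𝟙 ((Paths.of T.Graph).obj v))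
  | triangle {v w x : T.Graph} (e : v ⟶ w) (f : w ⟶ x) (g : v ⟶ x)
      (h : {v.vertex, w.vertex, x.vertex} ∈ T.complex.faces) :
      Rel ((Paths.of T.Graph).map e ≫ (Paths.of T.Graph).map f) ((Paths.of T.Graph).map g)

/-- The category `C(T)`: the quotient of the path category of `Γ(T)` by the above relations. -/
abbrev Cat : Type _ := CategoryTheory.Quotient T.Rel

/-- The functor `D : C(T) ⥤ 𝟑`, given on objects by the dimension of strata. -/
def toThree : T.Cat ⥤ Three :=
  CategoryTheory.Quotient.lift T.Rel
    (Paths.lift { obj := fun v => T.vdim v.vertex, map := fun e => homOfLE e.down.2.2 })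
    (fun _ _ _ _ _ => Subsingleton.elim _ _)

variable {C : Type*} [Category C]

/-- The `C`-colorings of `T`: functors `C(T) ⥤ C` over `𝟑`. -/
def Coloring (𝒞 : Parcel Three C) : Type _ := {F : T.Cat ⥤ C // F ⋙ 𝒞.U = T.toThree}

/-- The number of vertices of `T` in the stratum of dimension `i`. -/
def vertexCount (i : Three) : ℕ := Nat.card {v : V // T.vdim v = i}

/-- The untwisted state-sum `#[T, C] / ∏ i, #G_i ^ #T₀ⁱ`. -/
def stateSum (𝒞 : Parcel Three C) : ℚ :=
  (Nat.card (T.Coloring 𝒞) : ℚ) / ∏ i : Three, (𝒞.groupOrder i : ℚ) ^ T.vertexCount i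

end FlagLikeTriangulation

end

noncomputable section

/-! ## Counting functors over a poset -/

universe v₁ v₂ v₃ u₁ u₂ u₃ u₄

/-- A functor with prescribed values on objects. -/
@[ext]
structure FunctorOn {A : Type u₁} [Category.{v₁} A] {C : Type u₂} [Category.{v₂} C] (c : A → C) where
  map : ∀ {a b : A}, (a ⟶ b) → (c a ⟶ c b)
  map_id : ∀ a, map (𝟙 a) = 𝟙 (c a)
  map_comp : ∀ {a b d : A} (f : a ⟶ b) (g : b ⟶ d), map (f ≫ g) = map f ≫ map g

namespace FunctorOn

variable {A : Type u₁} [Category.{v₁} A] {C : Type u₂} [Category.{v₂} C]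
  {S : Type u₃} [Category.{v₃} S]

/-- Functors with prescribed values on objects, as a subtype of the type of functors. -/
def equivSubtype (c : A → C) : {F : A ⥤ C // F.obj = c} ≃ FunctorOn c where
  toFun F := F.2 ▸ ⟨F.1.map, F.1.map_id, F.1.map_comp⟩
  invFun F := ⟨{ obj := c, map := F.map, map_id := F.map_id, map_comp := F.map_comp }, rfl⟩
  left_inv := by rintro ⟨F, rfl⟩; rfl
  right_inv _ := rfl

/-- The image of an isomorphism. -/
@[simps]
def mapIso {c : A → C} (F : FunctorOn c) {a b : A} (e : a ≅ b) : c a ≅ c b where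
  hom := F.map e.hom
  inv := F.map e.inv
  hom_inv_id := by rw [← F.map_comp, e.hom_inv_id, F.map_id]
  inv_hom_id := by rw [← F.map_comp, e.inv_hom_id, F.map_id]

variable (G : S ⥤ A) [G.IsEquivalence] (c : A → C)

/-- For an equivalence `G : S ⥤ A`, both sides parametrise the triples consisting of a functor on
`S`, a functor on `A` and an isomorphism between the former and the restriction of the latter. -/
def prodIsoEquiv :
    (FunctorOn (fun s => c (G.obj s)) × ∀ a, c (G.obj (G.objPreimage a)) ≅ c a) ≃
      (FunctorOn c × ∀ s, c (G.obj s) ≅ c (G.obj s)) where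
  toFun p :=
    (⟨fun {a b} f => (p.2 a).inv ≫ p.1.map (G.preimage ((G.objObjPreimageIso a).hom ≫ f ≫
        (G.objObjPreimageIso b).inv)) ≫ (p.2 b).hom,
      fun a => by simp [p.1.map_id],
      fun {a b d} f g => by
        simp only [Category.assoc, Iso.hom_inv_id_assoc, Iso.cancel_iso_inv_left]
        rw [← Category.assoc (p.1.map _), ← p.1.map_comp]
        congr 2
        exact G.map_injective (by simp)⟩,
      fun s => p.1.mapIso (G.preimageIso (G.objObjPreimageIso (G.obj s)).symm) ≪≫ p.2 (G.obj s))
  invFun q :=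
    (⟨fun {a b} f => (q.2 a).hom ≫ q.1.map (G.map f) ≫ (q.2 b).inv,
      fun a => by simp [q.1.map_id],
      fun f g => by simp [q.1.map_comp]⟩,
      fun a => q.2 _ ≪≫ q.1.mapIso (G.objObjPreimageIso a))
  left_inv p := by
    have key : ∀ {s t : S} (f : s ⟶ t), p.1.map (G.preimage (G.objObjPreimageIso (G.obj s)).inv) ≫
        p.1.map (G.preimage ((G.objObjPreimageIso (G.obj s)).hom ≫ G.map f ≫
          (G.objObjPreimageIso (G.obj t)).inv)) ≫
        p.1.map (G.preimage (G.objObjPreimageIso (G.obj t)).hom) = p.1.map f := by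
      intro s t f
      rw [← p.1.map_comp, ← p.1.map_comp]
      congr 1
      exact G.map_injective (by simp)
    refine Prod.ext (FunctorOn.ext ?_) (funext fun a => Iso.ext ?_)
    · funext s t f
      simpa using key f
    · simp only [Iso.trans_hom, mapIso_hom, Functor.preimageIso_hom, Iso.symm_hom, Category.assoc,
        Iso.hom_inv_id_assoc]
      rw [← Category.assoc, ← p.1.map_comp]
      convert Category.id_comp _
      rw [← p.1.map_id]
      congr 1
      exact G.map_injective (by simp)
  right_inv q := by
    refine Prod.ext (FunctorOn.ext ?_) (funext fun s => Iso.ext ?_)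
    · funext a b f
      simp only [Iso.trans_hom, Iso.trans_inv, mapIso_hom, mapIso_inv, Functor.map_preimage,
        Category.assoc, Iso.inv_hom_id_assoc, q.1.map_comp]
      simp only [← mapIso_hom, ← mapIso_inv, Iso.inv_hom_id_assoc, Iso.inv_hom_id,
        Category.comp_id]
    · simp only [Iso.trans_hom, mapIso_hom, Functor.preimageIso_hom, Iso.symm_hom, Category.assoc,
        Iso.inv_hom_id_assoc, Functor.map_preimage, ← q.1.map_comp, Iso.inv_hom_id, q.1.map_id,
        Category.comp_id]

end FunctorOn

namespace Parcel

variable {P : Type u₄} [PartialOrder P] {C : Type u₂} [Category.{v₂} C] (𝒞 : Parcel P C)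
  {A : Type u₁} [Category.{v₁} A] {S : Type u₃} [Category.{v₃} S]

theorem U_obj_obj (i : P) : 𝒞.U.obj (𝒞.obj i) = i :=
  (Equiv.ofBijective 𝒞.U.obj 𝒞.bijective).apply_symm_apply i

theorem over_iff (D : A ⥤ P) (F : A ⥤ C) :
    F ⋙ 𝒞.U = D ↔ F.obj = fun a => 𝒞.obj (D.obj a) := by
  constructor
  · rintro rfl
    funext a
    exact 𝒞.bijective.1 (𝒞.U_obj_obj _).symm
  · intro h
    refine CategoryTheory.Functor.ext (fun a => ?_) fun _ _ _ => Subsingleton.elim _ _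
    rw [Functor.comp_obj, h, U_obj_obj]

/-- Functors over a poset, as functors with prescribed values on objects. -/
def overEquiv (D : A ⥤ P) :
    {F : A ⥤ C // F ⋙ 𝒞.U = D} ≃ FunctorOn fun a => 𝒞.obj (D.obj a) :=
  (Equiv.subtypeEquivRight (𝒞.over_iff D)).trans (FunctorOn.equivSubtype _)

theorem isIso_endo {i : P} (f : 𝒞.obj i ⟶ 𝒞.obj i) : IsIso f := by
  have := 𝒞.conservative
  have : IsIso (𝒞.U.map f) := by
    rw [Subsingleton.elim (𝒞.U.map f) (𝟙 _)]
    infer_instance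
  exact isIso_of_reflects_iso f 𝒞.U

/-- The automorphisms of an object of a parcel are its endomorphisms. -/
def isoEquiv (i : P) : (𝒞.obj i ≅ 𝒞.obj i) ≃ (𝒞.obj i ⟶ 𝒞.obj i) where
  toFun e := e.hom
  invFun f := have := 𝒞.isIso_endo f; asIso f
  left_inv _ := by ext; rfl
  right_inv _ := rfl

theorem card_iso {i j : P} (h : i = j) : Nat.card (𝒞.obj i ≅ 𝒞.obj j) = 𝒞.groupOrder j := by
  subst h
  exact Nat.card_congr (𝒞.isoEquiv i)

theorem groupOrder_pos [∀ a b : C, Finite (a ⟶ b)] (i : P) : 0 < 𝒞.groupOrder i :=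
  have : Nonempty (𝒞.obj i ⟶ 𝒞.obj i) := ⟨𝟙 _⟩
  Nat.card_pos

variable (G : S ⥤ A) [G.IsEquivalence] (D : A ⥤ P)

theorem finite_over_of_isEquivalence [∀ a b : C, Finite (a ⟶ b)] [Finite S] [Finite {F : A ⥤ C // F ⋙ 𝒞.U = D}] :
    Finite {F : S ⥤ C // F ⋙ 𝒞.U = G ⋙ D} := by
  have e (a) : 𝒞.obj (D.obj (G.obj (G.objPreimage a))) ≅ 𝒞.obj (D.obj a) :=
    eqToIso (congrArg 𝒞.obj ((D.mapIso (G.objObjPreimageIso a)).to_eq))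
  have h1 : Finite (FunctorOn fun a => 𝒞.obj (D.obj a)) := .of_equiv _ (𝒞.overEquiv D)
  have h2 (s : S) : Finite (𝒞.obj (D.obj (G.obj s)) ≅ 𝒞.obj (D.obj (G.obj s))) :=
    .of_equiv _ (𝒞.isoEquiv _).symm
  have h3 : Finite (FunctorOn fun s => 𝒞.obj (D.obj (G.obj s))) :=
    .of_injective (fun F => FunctorOn.prodIsoEquiv G (fun a => 𝒞.obj (D.obj a)) (F, e))
      fun F F' h => congrArg Prod.fst ((FunctorOn.prodIsoEquiv G _).injective h)
  exact @Finite.of_equiv _ _ h3 (𝒞.overEquiv (G ⋙ D)).symm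

variable [Fintype P]

theorem prod_groupOrder {α : Type*} [Finite α] (D : α → P) :
    ∏ᶠ a, 𝒞.groupOrder (D a) = ∏ i, 𝒞.groupOrder i ^ Nat.card {a // D a = i} := by
  classical
  have := Fintype.ofFinite α
  rw [finprod_eq_prod_of_fintype, ← Finset.prod_fiberwise_of_maps_to
    (s := Finset.univ) (t := Finset.univ) (g := D) (fun _ _ => Finset.mem_univ _)]
  refine Finset.prod_congr rfl fun i _ => ?_
  rw [Finset.prod_congr rfl fun a ha => by rw [(Finset.mem_filter.1 ha).2], Finset.prod_const,
    Nat.card_eq_fintype_card, Fintype.card_subtype]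

/-- The number of functors over a poset, divided by the orders of the groups of all objects, is
invariant under equivalence. -/
theorem card_over_mul_of_isEquivalence [Finite A] [Finite S] :
    Nat.card {F : S ⥤ C // F ⋙ 𝒞.U = G ⋙ D} *
        ∏ i, 𝒞.groupOrder i ^ Nat.card {a : A // D.obj a = i} =
      Nat.card {F : A ⥤ C // F ⋙ 𝒞.U = D} *
        ∏ i, 𝒞.groupOrder i ^ Nat.card {s : S // D.obj (G.obj s) = i} := by
  have := Fintype.ofFinite A
  have := Fintype.ofFinite S
  have h := Nat.card_congr (FunctorOn.prodIsoEquiv G fun a => 𝒞.obj (D.obj a))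
  rw [Nat.card_prod, Nat.card_prod, Nat.card_pi, Nat.card_pi] at h
  rw [Nat.card_congr (𝒞.overEquiv (G ⋙ D)), Nat.card_congr (𝒞.overEquiv D),
    ← 𝒞.prod_groupOrder, ← 𝒞.prod_groupOrder fun s => D.obj (G.obj s),
    finprod_eq_prod_of_fintype, finprod_eq_prod_of_fintype]
  simp only [𝒞.card_iso (D.mapIso (G.objObjPreimageIso _)).to_eq, 𝒞.card_iso rfl] at h
  exact h

end Parcel

/-! ## Chains of short intervals -/

/-- A transitive relation on a linear continuum which relates every point to all nearby points (in
increasing order) relates any two points. -/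
theorem rel_of_eventually_rel {α : Type*} [ConditionallyCompleteLinearOrder α] [TopologicalSpace α]
    [OrderTopology α] [DenselyOrdered α] {R : α → α → Prop} {a b : α} (hab : a ≤ b)
    (trans : ∀ {s t u}, a ≤ s → s ≤ t → t ≤ u → u ≤ b → R s t → R t u → R s u)
    (loc : ∀ t ∈ Set.Icc a b, ∀ᶠ s in 𝓝[Set.Icc a b] t, (s ≤ t → R s t) ∧ (t ≤ s → R t s)) :
    R a b := by
  set S : Set α := {t | t ∈ Set.Icc a b ∧ R a t} with hS
  have haS : a ∈ S :=
    ⟨⟨le_rfl, hab⟩, ((loc a ⟨le_rfl, hab⟩).self_of_nhdsWithin ⟨le_rfl, hab⟩).1 le_rfl⟩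
  have hbdd : BddAbove S := ⟨b, fun t ht => ht.1.2⟩
  have hlub := isLUB_csSup ⟨a, haS⟩ hbdd
  set c := sSup S
  have hac : a ≤ c := hlub.1 haS
  have hcb : c ≤ b := hlub.2 fun t ht => ht.1.2
  have hc := loc c ⟨hac, hcb⟩
  rw [eventually_nhdsWithin_iff] at hc
  have hcS : R a c := by
    obtain ⟨t, ht, htS, htc⟩ := ((hlub.frequently_mem ⟨a, haS⟩).and_eventually
      ((hc.filter_mono nhdsWithin_le_nhds).and self_mem_nhdsWithin)).exists
    exact trans le_rfl ht.1.1 htc hcb ht.2 ((htS ht.1).1 htc)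
  rcases hcb.eq_or_lt with h | h
  · rwa [h] at hcS
  · have : (𝓝[>] c).NeBot := nhdsGT_neBot_of_exists_gt ⟨b, h⟩
    obtain ⟨t, ht, htc⟩ :=
      ((hc.filter_mono nhdsWithin_le_nhds).and (Ioo_mem_nhdsGT h)).exists
    have htI : t ∈ Set.Icc a b := ⟨hac.trans htc.1.le, htc.2.le⟩
    exact absurd (hlub.1 (show t ∈ S from
      ⟨htI, trans le_rfl hac htc.1.le htI.2 hcS ((ht htI).2 htc.1.le)⟩)) (not_le.2 htc.1)

theorem eventually_forall_uIcc {α : Type*} [LinearOrder α] [TopologicalSpace α]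
    [OrderTopology α] {Q : α → Prop} {t : α}
    (h : ∀ᶠ s in 𝓝 t, Q s) : ∀ᶠ s in 𝓝 t, ∀ u ∈ Set.uIcc t s, Q u :=
  (tendsto_const_nhds.uIcc Filter.tendsto_id).eventually h.smallSets

/-! ## Directed paths -/

/-- The affine path between two points of the unit interval. -/
def unitInterval.affinePath (s t : I) : Path s t where
  toFun u := ⟨(1 - (u : ℝ)) * s + u * t, by
    have := u.2.1; have := u.2.2; have := s.2.1; have := s.2.2; have := t.2.1; have := t.2.2
    exact ⟨by nlinarith, by nlinarith⟩⟩
  continuous_toFun := by fun_prop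
  source' := by simp
  target' := by simp

theorem unitInterval.affinePath_apply (s t u : I) :
    (unitInterval.affinePath s t u : ℝ) = (1 - (u : ℝ)) * s + u * t := rfl

theorem unitInterval.affinePath_monotone {s t : I} (h : s ≤ t) :
    Monotone (unitInterval.affinePath s t) := by
  intro u v huv
  have h1 : (u : ℝ) ≤ v := huv
  have h2 : (s : ℝ) ≤ t := h
  apply Subtype.mk_le_mk.2
  nlinarith [mul_nonneg (sub_nonneg.2 h1) (sub_nonneg.2 h2)]

open unitInterval (affinePath affinePath_monotone)

theorem Path.monotone_trans {P : Type*} [TopologicalSpace P] [Preorder P] {x y z : P}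
    {p : Path x y} {q : Path y z} (hp : Monotone p) (hq : Monotone q) : Monotone (p.trans q) :=
  (DSpace.ofFun (id : P → P)).trans p q hp hq

namespace DSpace

variable {X : Type*} [TopologicalSpace X] (D : DSpace X)

/-- Monotone paths in a directed square with the same end points are homotopic if the first lies
below the second. -/
theorem dHomotopyRel_of_square_of_le {φ : C(I × I, X)} (hφ : D.IsDirectedSquare φ)
    {γ γ' : C(I, I × I)} (hγ : Monotone γ) (hγ' : Monotone γ') (hle : ∀ t, γ t ≤ γ' t)
    (h0 : γ 0 = γ' 0) (h1 : γ 1 = γ' 1) {x y : X} (p q : D.DPath x y)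
    (hp : ∀ t, p.1 t = φ (γ t)) (hq : ∀ t, q.1 t = φ (γ' t)) : D.DHomotopyRel p q := by
  let k : C(I × I, I × I) := ⟨fun z => (affinePath (γ z.2).1 (γ' z.2).1 z.1,
    affinePath (γ z.2).2 (γ' z.2).2 z.1), by
      simp only [affinePath, Path.coe_mk_mk]
      fun_prop⟩
  have mono : ∀ {s t a a' b b' : I}, s ≤ t → a ≤ b → a' ≤ b' → b ≤ b' →
      affinePath a a' s ≤ affinePath b b' t := by
    intro s t a a' b b' h1 h2 h3 h4
    refine le_trans ?_ (affinePath_monotone h4 h1)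
    have h2' : (a : ℝ) ≤ b := h2
    have h3' : (a' : ℝ) ≤ b' := h3
    apply Subtype.mk_le_mk.2
    nlinarith [mul_nonneg (sub_nonneg.2 s.2.2) (sub_nonneg.2 h2'),
      mul_nonneg s.2.1 (sub_nonneg.2 h3')]
  have hk : Monotone k := fun u v huv =>
    ⟨mono huv.1 (hγ huv.2).1 (hγ' huv.2).1 (hle _).1,
      mono huv.1 (hγ huv.2).2 (hγ' huv.2).2 (hle _).2⟩
  have k0 : ∀ t, k (0, t) = γ t := fun t => Prod.ext (Path.source _) (Path.source _)
  have k1 : ∀ t, k (1, t) = γ' t := fun t => Prod.ext (Path.target _) (Path.target _)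
  have kc : ∀ s t, γ t = γ' t → k (s, t) = γ t := by
    intro s t h
    refine Prod.ext (Subtype.ext ?_) (Subtype.ext ?_) <;>
    · simp only [k, unitInterval.affinePath_apply, ContinuousMap.coe_mk, ← h]
      ring
  refine ⟨⟨⟨φ.comp k, fun t => ?_, fun t => ?_⟩, fun s t ht => ?_⟩,
    fun δ hδ => hφ (k.comp δ) (hk.comp hδ)⟩
  · exact (congrArg φ (k0 t)).trans (hp t).symm
  · exact (congrArg φ (k1 t)).trans (hq t).symm
  · refine (congrArg φ (kc s t ?_)).trans (hp t).symm
    rcases ht with rfl | ht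
    · exact h0
    · rw [Set.mem_singleton_iff] at ht
      rw [ht, h1]

/-- Monotone paths in a directed square with the same end points represent the same arrow. -/
theorem mk_eq_of_square {φ : C(I × I, X)} (hφ : D.IsDirectedSquare φ)
    {γ γ' : C(I, I × I)} (hγ : Monotone γ) (hγ' : Monotone γ')
    (h0 : γ 0 = γ' 0) (h1 : γ 1 = γ' 1) {x y : X} (p q : D.DPath x y)
    (hp : ∀ t, p.1 t = φ (γ t)) (hq : ∀ t, q.1 t = φ (γ' t)) :
    (Quot.mk _ p : D.Arrow x y) = Quot.mk _ q := by
  let δ : C(I, I × I) := ⟨fun t => ((γ t).1 ⊔ (γ' t).1, (γ t).2 ⊔ (γ' t).2), by fun_prop⟩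
  have hδ : Monotone δ := fun s t h =>
    ⟨sup_le_sup (hγ h).1 (hγ' h).1, sup_le_sup (hγ h).2 (hγ' h).2⟩
  have d0 : δ 0 = γ 0 := by simp [δ, ← h0]
  have d1 : δ 1 = γ 1 := by simp [δ, ← h1]
  let r : D.DPath x y := ⟨⟨φ.comp δ, (congrArg φ d0).trans ((hp 0).symm.trans p.1.source),
    (congrArg φ d1).trans ((hp 1).symm.trans p.1.target)⟩, hφ δ hδ⟩
  have e1 : D.DHomotopyRel p r := D.dHomotopyRel_of_square_of_le hφ hγ hδ
    (fun t => ⟨le_sup_left, le_sup_left⟩) d0.symm d1.symm p r hp fun t => rfl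
  have e2 : D.DHomotopyRel q r := D.dHomotopyRel_of_square_of_le hφ hγ' hδ
    (fun t => ⟨le_sup_right, le_sup_right⟩) (h0.symm.trans d0.symm) (h1.symm.trans d1.symm)
    q r hq fun t => rfl
  exact (Quot.sound e1).trans (Quot.sound e2).symm

/-- The two boundary paths of a directed square represent the same arrow. -/
theorem mk_trans_eq_of_square {φ : C(I × I, X)} (hφ : D.IsDirectedSquare φ) {w x y z : X}
    (b : D.DPath w x) (r : D.DPath x z) (l : D.DPath w y) (t : D.DPath y z)
    (hb : ∀ u, b.1 u = φ (u, 0)) (hr : ∀ u, r.1 u = φ (1, u)) (hl : ∀ u, l.1 u = φ (0, u))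
    (ht : ∀ u, t.1 u = φ (u, 1)) :
    (Quot.mk _ (b.trans r) : D.Arrow w z) = Quot.mk _ (l.trans t) := by
  let b' : Path ((0, 0) : I × I) (1, 0) := (affinePath 0 1).prod (.refl 0)
  let r' : Path ((1, 0) : I × I) (1, 1) := (Path.refl 1).prod (affinePath 0 1)
  let l' : Path ((0, 0) : I × I) (0, 1) := (Path.refl 0).prod (affinePath 0 1)
  let t' : Path ((0, 1) : I × I) (1, 1) := (affinePath 0 1).prod (.refl 1)
  have haff : ∀ u, affinePath 0 1 u = u := fun u => Subtype.ext (by simp [unitInterval.affinePath_apply])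
  have ha : Monotone (affinePath 0 1) := affinePath_monotone unitInterval.nonneg'
  have hb' : Monotone b' := fun u v h => ⟨ha h, le_rfl⟩
  have hr' : Monotone r' := fun u v h => ⟨le_rfl, ha h⟩
  have hl' : Monotone l' := fun u v h => ⟨le_rfl, ha h⟩
  have ht' : Monotone t' := fun u v h => ⟨ha h, le_rfl⟩
  refine D.mk_eq_of_square hφ (γ := (b'.trans r').toContinuousMap)
    (γ' := (l'.trans t').toContinuousMap) (Path.monotone_trans hb' hr')
    (Path.monotone_trans hl' ht') ?_ ?_ _ _ ?_ ?_
  · exact (b'.trans r').source.trans (l'.trans t').source.symm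
  · exact (b'.trans r').target.trans (l'.trans t').target.symm
  · intro u
    change (b.1.trans r.1) u = φ ((b'.trans r') u)
    simp only [Path.trans_apply]
    split_ifs
    · rw [hb]; simp [b', haff]
    · rw [hr]; simp [r', haff]
  · intro u
    change (l.1.trans t.1) u = φ ((l'.trans t') u)
    simp only [Path.trans_apply]
    split_ifs
    · rw [hl]; simp [l', haff]
    · rw [ht]; simp [t', haff]

theorem isDirectedSquare_snd {c : C(I, X)} (hc : D.IsDirected c) :
    D.IsDirectedSquare (c.comp ⟨Prod.snd, continuous_snd⟩) :=
  fun γ hγ => D.reparam c ⟨fun t => (γ t).2, by fun_prop⟩ (fun _ _ h => (hγ h).2) hc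

/-- Monotone reparametrisations of a directed path with the same end points represent the same
arrow. -/
theorem mk_eq_of_reparam {c : C(I, X)} (hc : D.IsDirected c) {γ γ' : C(I, I)} (hγ : Monotone γ)
    (hγ' : Monotone γ') (h0 : γ 0 = γ' 0) (h1 : γ 1 = γ' 1) {x y : X} (p q : D.DPath x y)
    (hp : ∀ t, p.1 t = c (γ t)) (hq : ∀ t, q.1 t = c (γ' t)) :
    (Quot.mk _ p : D.Arrow x y) = Quot.mk _ q :=
  D.mk_eq_of_square (D.isDirectedSquare_snd hc) (γ := ⟨fun t => (0, γ t), by fun_prop⟩)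
    (γ' := ⟨fun t => (0, γ' t), by fun_prop⟩) (fun _ _ h => ⟨le_rfl, hγ h⟩)
    (fun _ _ h => ⟨le_rfl, hγ' h⟩) (Prod.ext rfl h0) (Prod.ext rfl h1) p q hp hq

/-- The segment of a directed path between two times. -/
def segment {c : C(I, X)} (hc : D.IsDirected c) {s t : I} (h : s ≤ t) : D.DPath (c s) (c t) :=
  ⟨(affinePath s t).map c.continuous, D.reparam c (affinePath s t).toContinuousMap
    (affinePath_monotone h) hc⟩

theorem mk_segment_trans {c : C(I, X)} (hc : D.IsDirected c) {s t u : I} (h : s ≤ t) (h' : t ≤ u) :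
    (Quot.mk _ ((D.segment hc h).trans (D.segment hc h')) : D.Arrow (c s) (c u)) =
      Quot.mk _ (D.segment hc (h.trans h')) := by
  refine D.mk_eq_of_reparam hc (γ := ((affinePath s t).trans (affinePath t u)).toContinuousMap)
    (γ' := (affinePath s u).toContinuousMap)
    (Path.monotone_trans (affinePath_monotone h) (affinePath_monotone h'))
    (affinePath_monotone (h.trans h')) ?_ ?_ _ _ (fun v => ?_) (fun v => rfl)
  · exact (Path.source _).trans (Path.source _).symm
  · exact (Path.target _).trans (Path.target _).symm
  · exact congrFun (congrArg DFunLike.coe (Path.map_trans _ _ c.continuous).symm) v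

end DSpace

/-! ## Transport along directed paths -/

/-- Data for transport along directed paths in a stratified space: an object at every point, and
morphisms from the object at a point to the objects at all nearby points, which are compatible with
each other and are isomorphisms along strata. -/
structure TransportSystem {M : Type*} [TopologicalSpace M] {P : Type*} [PartialOrder P] (d : M → P)
    (E : Type*) [Category E] where
  obj : M → E
  Adj : M → M → Prop
  sp : ∀ {x y : M}, Adj x y → (obj x ⟶ obj y)
  eventually_adj : ∀ x, ∀ᶠ y in 𝓝 x, Adj x y
  le : ∀ {x y}, Adj x y → d x ≤ d y
  sp_self : ∀ {x} (h : Adj x x), sp h = 𝟙 (obj x)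
  sp_comp : ∀ {x y z} (h : Adj x y) (h' : Adj y z) (h'' : Adj x z), sp h ≫ sp h' = sp h''
  isIso_sp : ∀ {x y} (h : Adj x y), d x = d y → IsIso (sp h)

namespace TransportSystem

variable {M : Type*} [TopologicalSpace M] {P : Type*} [PartialOrder P] {d : M → P}
  {E : Type*} [Category E] (τ : TransportSystem d E) (c : E)

/-- A point together with a morphism from a fixed object to the object at this point. -/
abbrev Germ := Σ y : M, (c ⟶ τ.obj y)

variable {τ c}

/-- The germ `b` is the specialisation of the germ `a` at a nearby point. -/
def Near (a b : τ.Germ c) : Prop := ∃ h : τ.Adj a.1 b.1, b.2 = a.2 ≫ τ.sp h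

theorem adj_self (x : M) : τ.Adj x x := (τ.eventually_adj x).self_of_nhds

theorem Near.right_unique {a b b' : τ.Germ c} (h : Near a b) (h' : Near a b') (hb : b.1 = b'.1) :
    b = b' := by
  obtain ⟨y, b⟩ := b
  obtain ⟨y', b'⟩ := b'
  obtain rfl : y = y' := hb
  obtain ⟨h, e⟩ := h
  obtain ⟨h', e'⟩ := h'
  simp only at e e'
  rw [e, e']

theorem Near.left_unique {a a' b : τ.Germ c} (h : Near a b) (h' : Near a' b) (ha : a.1 = a'.1)
    (hd : d a.1 = d b.1) : a = a' := by
  obtain ⟨y, a⟩ := a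
  obtain ⟨y', a'⟩ := a'
  obtain rfl : y = y' := ha
  obtain ⟨h, e⟩ := h
  obtain ⟨h', e'⟩ := h'
  have := τ.isIso_sp h hd
  simp only at e e'
  rw [e, cancel_mono] at e'
  rw [e']

/-- A lift of a path to germs, over a set of times, which is locally given by specialisation. -/
structure IsLiftOn (p : I → M) (ℓ : I → τ.Germ c) (s : Set I) : Prop where
  fst : ∀ t ∈ s, (ℓ t).1 = p t
  near : ∀ t ∈ s, ∀ᶠ u in 𝓝[s] t, Near (ℓ t) (ℓ u)

theorem IsLiftOn.mono {p : I → M} {ℓ : I → τ.Germ c} {s t : Set I} (h : IsLiftOn p ℓ t)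
    (hst : s ⊆ t) : IsLiftOn p ℓ s :=
  ⟨fun u hu => h.fst u (hst hu), fun u hu => (h.near u (hst hu)).filter_mono (nhdsWithin_mono _ hst)⟩

theorem IsLiftOn.congr {p : I → M} {ℓ ℓ' : I → τ.Germ c} {s : Set I} (h : IsLiftOn p ℓ s)
    (hs : ∀ t ∈ s, ℓ' t = ℓ t) : IsLiftOn p ℓ' s := by
  refine ⟨fun u hu => hs u hu ▸ h.fst u hu, fun u hu => ?_⟩
  filter_upwards [h.near u hu, self_mem_nhdsWithin] with v hv hvs
  rwa [hs u hu, hs v hvs]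

theorem IsLiftOn.union {p : I → M} {ℓ : I → τ.Germ c} {s t : Set I} (hs : IsLiftOn p ℓ s)
    (ht : IsLiftOn p ℓ t) (cs : IsClosed s) (ct : IsClosed t) : IsLiftOn p ℓ (s ∪ t) := by
  refine ⟨fun u hu => hu.elim (hs.fst u) (ht.fst u), fun u _ => ?_⟩
  have key : ∀ {s : Set I}, IsLiftOn p ℓ s → IsClosed s → ∀ᶠ v in 𝓝[s] u, Near (ℓ u) (ℓ v) := by
    intro s hs cs
    by_cases h : u ∈ s
    · exact hs.near u h
    · rw [notMem_closure_iff_nhdsWithin_eq_bot.1 (by rwa [cs.closure_eq])]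
      trivial
  rw [nhdsWithin_union]
  exact Filter.eventually_sup.2 ⟨key hs cs, key ht ct⟩

theorem IsLiftOn.comp {p : I → M} {ℓ : I → τ.Germ c} (hℓ : IsLiftOn p ℓ Set.univ) {h : I → I}
    (hh : Continuous h) : IsLiftOn (p ∘ h) (ℓ ∘ h) Set.univ := by
  refine ⟨fun t _ => hℓ.fst _ trivial, fun t _ => ?_⟩
  have := hℓ.near (h t) trivial
  rw [nhdsWithin_univ] at this ⊢
  exact hh.continuousAt.eventually this

/-- Precomposition of germs with a morphism. -/
def Germ.precomp {c' : E} (k : c' ⟶ c) (e : τ.Germ c) : τ.Germ c' := ⟨e.1, k ≫ e.2⟩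

theorem IsLiftOn.precomp {c' : E} (k : c' ⟶ c) {p : I → M} {ℓ : I → τ.Germ c} {s : Set I}
    (hℓ : IsLiftOn p ℓ s) : IsLiftOn p (fun t => (ℓ t).precomp k) s :=
  ⟨hℓ.fst, fun t ht => (hℓ.near t ht).mono fun u ⟨h, e⟩ =>
    ⟨h, by simp only [Germ.precomp, e, Category.assoc]⟩⟩

open Classical in
/-- The lift of a path which stays near a point `x`, obtained by specialisation of a germ at `x`. -/
def spread (a : τ.Germ c) (p : I → M) (t : I) : τ.Germ c :=
  if h : τ.Adj a.1 (p t) then ⟨p t, a.2 ≫ τ.sp h⟩ else a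

theorem near_spread (a : τ.Germ c) {p : I → M} {t : I} (h : τ.Adj a.1 (p t)) :
    Near a (spread a p t) := by
  rw [spread, dif_pos h]
  exact ⟨h, rfl⟩

theorem spread_fst (a : τ.Germ c) {p : I → M} {t : I} (h : τ.Adj a.1 (p t)) :
    (spread a p t).1 = p t := by
  rw [spread, dif_pos h]

theorem Near.trans {a b b' : τ.Germ c} (h : Near a b) (h' : Near b b') (hb : τ.Adj a.1 b'.1) :
    Near a b' :=
  ⟨hb, by rw [h'.2, h.2, Category.assoc, τ.sp_comp]⟩

/-- If `b` and `b'` are specialisations of `a`, then `b'` is the specialisation of `b`. -/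
theorem Near.of_near {a b b' : τ.Germ c} (h : Near a b) (h' : Near a b') (hb : τ.Adj b.1 b'.1) :
    Near b b' :=
  ⟨hb, by rw [h'.2, h.2, Category.assoc, τ.sp_comp]⟩

theorem isLiftOn_spread (a : τ.Germ c) {p : I → M} (hp : Continuous p) {s : Set I}
    (hs : ∀ t ∈ s, τ.Adj a.1 (p t)) : IsLiftOn p (spread a p) s := by
  refine ⟨fun t ht => spread_fst a (hs t ht), fun t ht => ?_⟩
  filter_upwards [self_mem_nhdsWithin,
    (hp.continuousAt.eventually (τ.eventually_adj (p t))).filter_mono nhdsWithin_le_nhds]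
    with u hu hu'
  refine (near_spread a (hs t ht)).of_near (near_spread a (hs u hu)) ?_
  rwa [spread_fst a (hs t ht), spread_fst a (hs u hu)]

variable {p : I → M} (hp : Continuous p) (hd : Monotone fun t => d (p t))

variable (τ) in
include τ hp hd in
theorem eventually_d_eq (t : I) : ∀ᶠ s in 𝓝 t, s ≤ t → d (p t) = d (p s) := by
  filter_upwards [hp.continuousAt.eventually (τ.eventually_adj (p t))] with s hs hst
  exact (τ.le hs).antisymm (hd hst)

include hp hd in
/-- A lift is determined by its initial value. -/
theorem IsLiftOn.eq_of_eq {ℓ ℓ' : I → τ.Germ c} {a b : I} (hab : a ≤ b)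
    (h : IsLiftOn p ℓ (Set.Icc a b)) (h' : IsLiftOn p ℓ' (Set.Icc a b)) (ha : ℓ a = ℓ' a) :
    ℓ b = ℓ' b := by
  refine rel_of_eventually_rel (R := fun s t => ℓ s = ℓ' s → ℓ t = ℓ' t) hab
    (fun _ _ _ _ h1 h2 h => h2 (h1 h)) (fun t ht => ?_) ha
  filter_upwards [h.near t ht, h'.near t ht, self_mem_nhdsWithin,
    (eventually_d_eq τ hp hd t).filter_mono nhdsWithin_le_nhds] with s hs hs' hsI hsd
  constructor
  · intro hst e
    rw [← e] at hs'
    refine hs.left_unique hs' ((h.fst t ht).trans (h'.fst t ht).symm) ?_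
    rw [h.fst t ht, h.fst s hsI, hsd hst]
  · intro hst e
    rw [← e] at hs'
    exact hs.right_unique hs' ((h.fst s hsI).trans (h'.fst s hsI).symm)

include hp hd in
/-- A lift which starts as a specialisation of a germ `e`, over a path near `e`, remains one. -/
theorem IsLiftOn.near_of_near {ℓ : I → τ.Germ c} {a b : I} (hab : a ≤ b)
    (h : IsLiftOn p ℓ (Set.Icc a b)) {e : τ.Germ c} (he : ∀ t ∈ Set.Icc a b, τ.Adj e.1 (p t))
    (ha : Near e (ℓ a)) : Near e (ℓ b) := by
  have haI : a ∈ Set.Icc a b := ⟨le_rfl, hab⟩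
  have hbI : b ∈ Set.Icc a b := ⟨hab, le_rfl⟩
  have e1 : ℓ a = spread e p a := ha.right_unique (near_spread e (he a haI))
    ((h.fst a haI).trans (spread_fst e (he a haI)).symm)
  rw [h.eq_of_eq hp hd hab (isLiftOn_spread e hp he) e1]
  exact near_spread e (he b hbI)

include hp hd in
theorem exists_isLiftOn_Icc {a b : I} (hab : a ≤ b) :
    ∀ e : τ.Germ c, e.1 = p a → ∃ ℓ : I → τ.Germ c, IsLiftOn p ℓ (Set.Icc a b) ∧ ℓ a = e := by
  refine rel_of_eventually_rel (R := fun a b => ∀ e : τ.Germ c, e.1 = p a →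
    ∃ ℓ : I → τ.Germ c, IsLiftOn p ℓ (Set.Icc a b) ∧ ℓ a = e) hab ?_ fun t ht => ?_
  · intro s t u _ hst htu _ h1 h2 e he
    obtain ⟨ℓ, hℓ, rfl⟩ := h1 e he
    obtain ⟨ℓ', hℓ', e'⟩ := h2 (ℓ t) (hℓ.fst t ⟨hst, le_rfl⟩)
    refine ⟨fun v => if v ≤ t then ℓ v else ℓ' v, ?_, if_pos hst⟩
    rw [← Set.Icc_union_Icc_eq_Icc hst htu]
    refine (hℓ.congr fun v hv => if_pos hv.2).union (hℓ'.congr fun v hv => ?_)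
      isClosed_Icc isClosed_Icc
    rcases hv.1.eq_or_lt with rfl | h
    · rw [if_pos le_rfl, e']
    · exact if_neg (not_le.2 h)
  · refine Filter.Eventually.filter_mono nhdsWithin_le_nhds ?_
    filter_upwards [eventually_forall_uIcc
      (hp.continuousAt.eventually (τ.eventually_adj (p t))),
      eventually_d_eq τ hp hd t] with s hs hsd
    constructor
    · intro hst e he
      rw [Set.uIcc_of_ge hst] at hs
      have hadj := hs s ⟨le_rfl, hst⟩
      have := τ.isIso_sp hadj (hsd hst)
      obtain ⟨y, e⟩ := e
      obtain rfl : y = p s := he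
      refine ⟨_, isLiftOn_spread ⟨p t, e ≫ inv (τ.sp hadj)⟩ hp hs, ?_⟩
      rw [spread, dif_pos hadj]
      simp
    · intro hst e he
      rw [Set.uIcc_of_le hst, ← he] at hs
      refine ⟨_, isLiftOn_spread e hp hs, (near_spread e (hs t ⟨le_rfl, hst⟩)).right_unique
        ⟨adj_self e.1, by rw [τ.sp_self, Category.comp_id]⟩ ?_⟩
      rw [spread_fst e (hs t ⟨le_rfl, hst⟩), he]

theorem near_self (a : τ.Germ c) : Near a a :=
  ⟨adj_self _, by rw [τ.sp_self, Category.comp_id]⟩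

/-- Transport of a germ along a path. -/
def Transports (p : I → M) (e f : τ.Germ c) : Prop :=
  ∃ ℓ, IsLiftOn p ℓ Set.univ ∧ ℓ 0 = e ∧ ℓ 1 = f

theorem Icc_zero_one : Set.Icc (0 : I) 1 = Set.univ :=
  Set.eq_univ_of_forall fun _ => ⟨unitInterval.nonneg', unitInterval.le_one'⟩

include hp hd in
theorem Transports.unique {e f f' : τ.Germ c} (h : Transports p e f) (h' : Transports p e f') :
    f = f' := by
  obtain ⟨ℓ, hℓ, rfl, rfl⟩ := h
  obtain ⟨ℓ', hℓ', e', rfl⟩ := h'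
  rw [← Icc_zero_one] at hℓ hℓ'
  exact hℓ.eq_of_eq hp hd unitInterval.nonneg' hℓ' e'.symm

include hp hd in
theorem exists_transports {x y : M} (hx : p 0 = x) (hy : p 1 = y) (e : c ⟶ τ.obj x) :
    ∃ f : c ⟶ τ.obj y, Transports p ⟨x, e⟩ ⟨y, f⟩ := by
  subst hx hy
  obtain ⟨ℓ, hℓ, e'⟩ := exists_isLiftOn_Icc hp hd unitInterval.nonneg' ⟨p 0, e⟩ rfl
  rw [Icc_zero_one] at hℓ
  have h1 := hℓ.fst 1 trivial
  refine ⟨h1 ▸ (ℓ 1).2, ℓ, hℓ, e', ?_⟩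
  generalize ℓ 1 = g at h1 ⊢
  obtain ⟨y, g⟩ := g
  obtain rfl : y = p 1 := h1
  rfl

theorem Transports.precomp {c' : E} (k : c' ⟶ c) {e f : τ.Germ c} (h : Transports p e f) :
    Transports p (e.precomp k) (f.precomp k) := by
  obtain ⟨ℓ, hℓ, rfl, rfl⟩ := h
  exact ⟨_, hℓ.precomp k, rfl, rfl⟩

theorem transports_const (e : τ.Germ c) : Transports (fun _ => e.1) e e :=
  ⟨fun _ => e, ⟨fun _ _ => rfl, fun _ _ => .of_forall fun _ => near_self e⟩, rfl, rfl⟩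

include hp in
theorem transports_of_adj {x y : M} (hx : p 0 = x) (hy : p 1 = y) {z : M} (a : c ⟶ τ.obj z)
    (h : ∀ t, τ.Adj z (p t)) (hzx : τ.Adj z x) (hzy : τ.Adj z y) :
    Transports p (⟨x, a ≫ τ.sp hzx⟩ : τ.Germ c) ⟨y, a ≫ τ.sp hzy⟩ := by
  subst hx hy
  exact ⟨spread ⟨z, a⟩ p, isLiftOn_spread ⟨z, a⟩ hp fun t _ => h t, dif_pos (h 0), dif_pos (h 1)⟩

/-- The midpoint of the unit interval. -/
def _root_.unitInterval.half : I := ⟨1 / 2, by norm_num, by norm_num⟩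

theorem _root_.unitInterval.coe_half : (unitInterval.half : ℝ) = 1 / 2 := rfl

theorem Transports.trans {x y z : M} {p : Path x y} {q : Path y z} {e f g : τ.Germ c}
    (hpd : Monotone fun t => d (p t)) (hqd : Monotone fun t => d (q t))
    (h : Transports p e f) (h' : Transports q f g) : Transports (p.trans q) e g := by
  have hd : Monotone fun t => d ((p.trans q) t) := (DSpace.ofFun d).trans p q hpd hqd
  have hex : e.1 = (p.trans q) 0 := by
    obtain ⟨ℓ, hℓ, rfl, -⟩ := h
    rw [hℓ.fst 0 trivial, p.source, (p.trans q).source]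
  obtain ⟨ℓ, hℓ, hℓ0⟩ := exists_isLiftOn_Icc (p.trans q).continuous hd unitInterval.nonneg' e hex
  rw [Icc_zero_one] at hℓ
  have hlo : p = (p.trans q) ∘ unitInterval.affinePath 0 unitInterval.half := by
    funext t
    have ht : ((unitInterval.affinePath 0 unitInterval.half t : I) : ℝ) = t / 2 := by
      rw [unitInterval.affinePath_apply, unitInterval.coe_half]; simp [div_eq_mul_inv]
    rw [Function.comp_apply, Path.trans_apply, dif_pos (by rw [ht]; linarith [t.2.2])]
    exact congrArg p (Subtype.ext (by simp only [ht]; ring))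
  have hhi : q = (p.trans q) ∘ unitInterval.affinePath unitInterval.half 1 := by
    funext t
    have ht : ((unitInterval.affinePath unitInterval.half 1 t : I) : ℝ) = (1 + t) / 2 := by
      rw [unitInterval.affinePath_apply, unitInterval.coe_half, Set.Icc.coe_one]; ring
    rw [Function.comp_apply, Path.trans_apply]
    split_ifs with h0
    · have h00 : t = 0 := Subtype.ext (le_antisymm (by
        rw [ht] at h0; change (t : ℝ) ≤ 0; linarith) t.2.1)
      subst h00
      exact q.source.trans (p.target.symm.trans (congrArg p (Subtype.ext (by simp [unitInterval.coe_half]))))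
    · exact congrArg q (Subtype.ext (by simp only [ht]; ring))
  have hℓp := hℓ.comp (unitInterval.affinePath 0 unitInterval.half).continuous
  have hℓq := hℓ.comp (unitInterval.affinePath unitInterval.half 1).continuous
  rw [← hlo] at hℓp
  rw [← hhi] at hℓq
  have e1 : ℓ unitInterval.half = f :=
    Transports.unique p.continuous hpd
      ⟨_, hℓp, (congrArg ℓ (Path.source _)).trans hℓ0, congrArg ℓ (Path.target _)⟩ h
  exact ⟨ℓ, hℓ, hℓ0, Transports.unique q.continuous hqd
    ⟨_, hℓq, (congrArg ℓ (Path.source _)).trans e1, congrArg ℓ (Path.target _)⟩ h'⟩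

/-- Lifts of nearby directed paths are near each other if they start near each other. -/
theorem eventually_near {S : Type*} [TopologicalSpace S] {H : S × I → M} (hH : Continuous H)
    (hd : ∀ s, Monotone fun t => d (H (s, t))) {ℓ : S → I → τ.Germ c}
    (hℓ : ∀ s, IsLiftOn (fun t => H (s, t)) (ℓ s) Set.univ) (s₀ : S)
    (h0 : ∀ᶠ s in 𝓝 s₀, Near (ℓ s₀ 0) (ℓ s 0)) : ∀ᶠ s in 𝓝 s₀, Near (ℓ s₀ 1) (ℓ s 1) := by
  have hf : ∀ s t, (ℓ s t).1 = H (s, t) := fun s t => (hℓ s).fst t trivial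
  have hc : ∀ s, Continuous fun t => H (s, t) := fun s => by fun_prop
  have hc' : ∀ t, Continuous fun s => H (s, t) := fun t => by fun_prop
  refine rel_of_eventually_rel (a := (0 : I)) (b := 1) (R := fun t t' =>
    (∀ᶠ s in 𝓝 s₀, Near (ℓ s₀ t) (ℓ s t)) → ∀ᶠ s in 𝓝 s₀, Near (ℓ s₀ t') (ℓ s t'))
    unitInterval.nonneg' (fun _ _ _ _ h1 h2 h => h2 (h1 h)) (fun t₀ _ => ?_) h0
  refine Filter.Eventually.filter_mono nhdsWithin_le_nhds ?_
  have hadj := hH.continuousAt.eventually (τ.eventually_adj (H (s₀, t₀)))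
  rw [nhds_prod_eq] at hadj
  obtain ⟨A, hA, B, hB, hAB⟩ := Filter.eventually_prod_iff.1 hadj
  have hn := (hℓ s₀).near t₀ trivial
  rw [nhdsWithin_univ] at hn
  filter_upwards [hn, eventually_forall_uIcc hB] with t ht htB
  constructor
  · intro htt h
    rw [Set.uIcc_of_ge htt] at htB
    filter_upwards [h, hA] with s hs hsA
    have hadj : ∀ u ∈ Set.Icc t t₀, τ.Adj (ℓ s₀ t₀).1 (H (s, u)) := fun u hu => by
      rw [hf]; exact hAB hsA (htB u hu)
    refine ((hℓ s).mono (Set.subset_univ _)).near_of_near (hc s) (hd s) htt hadj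
      (ht.trans hs ?_)
    rw [hf s]
    exact hadj t ⟨le_rfl, htt⟩
  · intro htt h
    rw [Set.uIcc_of_le htt] at htB
    filter_upwards [h, hA, (hc' t).continuousAt.eventually (τ.eventually_adj (H (s₀, t)))]
      with s hs hsA hsadj
    have hadj : ∀ u ∈ Set.Icc t₀ t, τ.Adj (ℓ s₀ t₀).1 (H (s, u)) := fun u hu => by
      rw [hf]; exact hAB hsA (htB u hu)
    refine ht.of_near (((hℓ s).mono (Set.subset_univ _)).near_of_near (hc s) (hd s) htt hadj hs) ?_
    rwa [hf, hf]

theorem Transports.eq_of_homotopy {x y : M} {p q : (DSpace.ofFun d).DPath x y}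
    (h : (DSpace.ofFun d).DHomotopyRel p q) {e f f' : τ.Germ c} (hp : Transports p.1 e f)
    (hq : Transports q.1 e f') : f = f' := by
  obtain ⟨H, hH⟩ := h
  have hd : ∀ s, Monotone fun t => d (H (s, t)) := fun s =>
    hH ⟨fun t => (s, t), by fun_prop⟩ fun _ _ h => ⟨le_rfl, h⟩
  have he : e.1 = x := by
    obtain ⟨ℓ, hℓ, rfl, -⟩ := hp
    rw [hℓ.fst 0 trivial, p.1.source]
  have hs : ∀ s, ∃ ℓ : I → τ.Germ c, IsLiftOn (fun t => H (s, t)) ℓ (Set.Icc 0 1) ∧ ℓ 0 = e :=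
    fun s => exists_isLiftOn_Icc (by fun_prop) (hd s) unitInterval.nonneg' e (by simp [he])
  choose ℓ hℓ hℓ0 using hs
  rw [Icc_zero_one] at hℓ
  have key : ∀ s₀, ∀ᶠ s in 𝓝 s₀, ℓ s 1 = ℓ s₀ 1 := by
    intro s₀
    filter_upwards [eventually_near H.continuous hd hℓ s₀
      (.of_forall fun s => by rw [hℓ0, hℓ0]; exact near_self e)] with s hs
    refine (near_self _).right_unique hs ?_ |>.symm
    rw [(hℓ _).fst _ trivial, (hℓ _).fst _ trivial]
    simp
  have hloc : IsLocallyConstant fun s => ℓ s 1 :=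
    (IsLocallyConstant.iff_eventually_eq _).2 key
  have e01 := hloc.apply_eq_of_isPreconnected isPreconnected_univ (Set.mem_univ 0) (Set.mem_univ 1)
  have e0 : f = ℓ 0 1 := hp.unique p.1.continuous p.2
    ⟨ℓ 0, (by simpa using hℓ 0 : IsLiftOn p.1 (ℓ 0) Set.univ), hℓ0 0, rfl⟩
  have e1 : f' = ℓ 1 1 := hq.unique q.1.continuous q.2
    ⟨ℓ 1, (by simpa using hℓ 1 : IsLiftOn q.1 (ℓ 1) Set.univ), hℓ0 1, rfl⟩
  rw [e0, e1, e01]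

variable (τ)

/-- Transport along a directed path, as a morphism. -/
def pathMap {x y : M} (p : (DSpace.ofFun d).DPath x y) : τ.obj x ⟶ τ.obj y :=
  (exists_transports (τ := τ) p.1.continuous p.2 p.1.source p.1.target (𝟙 (τ.obj x))).choose

theorem transports_pathMap {x y : M} (p : (DSpace.ofFun d).DPath x y) (e : c ⟶ τ.obj x) :
    Transports p.1 (⟨x, e⟩ : τ.Germ c) ⟨y, e ≫ τ.pathMap p⟩ := by
  have := (exists_transports (τ := τ) p.1.continuous p.2 p.1.source p.1.target
    (𝟙 (τ.obj x))).choose_spec.precomp e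
  rwa [Germ.precomp, Germ.precomp, Category.comp_id] at this

variable {τ}

theorem eq_comp_pathMap {x y : M} {p : (DSpace.ofFun d).DPath x y} {e : c ⟶ τ.obj x}
    {f : c ⟶ τ.obj y} (h : Transports p.1 (⟨x, e⟩ : τ.Germ c) ⟨y, f⟩) : e ≫ τ.pathMap p = f :=
  eq_of_heq (Sigma.mk.inj_iff.1 ((τ.transports_pathMap p e).unique p.1.continuous p.2 h)).2

theorem sp_comp_pathMap {x y z : M} (p : (DSpace.ofFun d).DPath x y) (h : ∀ t, τ.Adj z (p.1 t))
    (hx : τ.Adj z x) (hy : τ.Adj z y) : τ.sp hx ≫ τ.pathMap p = τ.sp hy := by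
  have := transports_of_adj p.1.continuous p.1.source p.1.target (𝟙 (τ.obj z)) h hx hy
  rw [Category.id_comp, Category.id_comp] at this
  exact eq_comp_pathMap this

variable (τ)

/-- Transport along directed paths, as a functor on the fundamental category. -/
def functor : (DSpace.ofFun d).FundamentalCategory ⥤ E where
  obj x := τ.obj x.pt
  map := Quot.lift τ.pathMap fun p q h => by
    have e := (τ.transports_pathMap p (𝟙 _)).eq_of_homotopy h (τ.transports_pathMap q (𝟙 _))
    simpa using e
  map_id x := by
    have := eq_comp_pathMap (p := DSpace.DPath.refl (DSpace.ofFun d) x.pt)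
      (transports_const (⟨x.pt, 𝟙 (τ.obj x.pt)⟩ : τ.Germ _))
    rwa [Category.id_comp] at this
  map_comp {x y z} f g := by
    induction f using Quot.inductionOn with | _ p
    induction g using Quot.inductionOn with | _ q
    have := eq_comp_pathMap (p := p.trans q) ((τ.transports_pathMap p (𝟙 _)).trans p.2 q.2
      (τ.transports_pathMap q _))
    rw [Category.id_comp] at this
    exact this.trans (by rw [Category.id_comp])

end TransportSystem

/-! ## Geometry of flag-like triangulations -/

/-- The functor from the fundamental category to the chain `1 < 2 < 3` given by the dimension of
strata. -/
def KnotSurfaceTriple.dimFunctor {M : Type*} [TopologicalSpace M] (X : KnotSurfaceTriple M) :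
    X.dSpace.FundamentalCategory ⥤ Three where
  obj x := X.dim x.pt
  map {x y} := Quot.lift (fun p => homOfLE (by
    have h : X.dim (p.1 0) ≤ X.dim (p.1 1) := p.2 unitInterval.nonneg'
    rwa [p.1.source, p.1.target] at h)) fun _ _ _ => Subsingleton.elim _ _
  map_id _ := Subsingleton.elim _ _
  map_comp _ _ := Subsingleton.elim _ _

open AbstractSimplicialComplex

theorem AbstractSimplicialComplex.mem_support {V : Type*} [Fintype V] {x : V → ℝ} {v : V} :
    v ∈ support x ↔ x v ≠ 0 := by
  simp [support]

theorem AbstractSimplicialComplex.support_vertex {V : Type*} [Fintype V]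
    (T : AbstractSimplicialComplex V) (v : V) : support (T.vertex v).1 = {v} := by
  classical
  ext w
  by_cases h : w = v <;> simp [mem_support, vertex, h]

namespace FlagLikeTriangulation

variable {M : Type*} [TopologicalSpace M] {X : KnotSurfaceTriple M} {V : Type*} [Fintype V]
  [DecidableEq V] (T : FlagLikeTriangulation X V)

/-- The barycentric coordinates of a point. -/
def bary (x : M) : V → ℝ := (T.homeo.symm x).1

/-- The vertices of the smallest simplex which contains a point. -/
def supp (x : M) : Finset V := support (T.bary x)

/-- A vertex, as a point of the triangulated space. -/
def pt (v : V) : M := T.homeo (T.complex.vertex v)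

omit [DecidableEq V]

theorem bary_nonneg (x : M) (v : V) : 0 ≤ T.bary x v := (T.homeo.symm x).2.1 v

theorem sum_bary (x : M) : ∑ v, T.bary x v = 1 := (T.homeo.symm x).2.2.1

theorem supp_mem_faces (x : M) : T.supp x ∈ T.complex.faces := (T.homeo.symm x).2.2.2

theorem mem_supp {x : M} {v : V} : v ∈ T.supp x ↔ T.bary x v ≠ 0 := mem_support

theorem supp_pt (v : V) : T.supp (T.pt v) = {v} := by
  rw [supp, bary, pt, Homeomorph.symm_apply_apply, support_vertex]

theorem mem_faces_of_subset {s t : Finset V} (hs : s ∈ T.complex.faces) (ht : t ⊆ s)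
    (hne : t.Nonempty) : t ∈ T.complex.faces :=
  (T.complex.isRelLowerSet_faces hs).2 ht hne

theorem continuous_bary : Continuous T.bary := by
  unfold bary
  fun_prop

theorem eventually_mem_supp {x : M} {v : V} (h : v ∈ T.supp x) : ∀ᶠ y in 𝓝 x, v ∈ T.supp y := by
  have hc : Continuous fun y => T.bary y v := (continuous_apply v).comp T.continuous_bary
  filter_upwards [hc.continuousAt.eventually_ne (T.mem_supp.1 h)] with y hy
  exact T.mem_supp.2 hy

theorem mem_iff_of_flag {A : Set M} (hA : ∀ s ∈ T.complex.faces, ∃ t ⊆ s,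
    T.homeo ⁻¹' A ∩ T.complex.closedSimplex s = T.complex.closedSimplex t) (x : M) :
    x ∈ A ↔ ∀ v ∈ T.supp x, T.pt v ∈ A := by
  obtain ⟨t, hts, ht⟩ := hA _ (T.supp_mem_faces x)
  have key : ∀ y, T.supp y ⊆ T.supp x → (y ∈ A ↔ T.supp y ⊆ t) := by
    intro y hy
    have h := Set.ext_iff.1 ht (T.homeo.symm y)
    simp only [Set.mem_inter_iff, Set.mem_preimage, Homeomorph.apply_symm_apply] at h
    exact ⟨fun hyA => h.1 ⟨hyA, hy⟩, fun hyt => (h.2 hyt).1⟩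
  rw [key x subset_rfl]
  refine forall₂_congr fun v hv => ?_
  rw [key (T.pt v) (by rw [supp_pt]; simpa using hv), supp_pt, Finset.singleton_subset_iff]

theorem vdim_le {x : M} {v : V} (h : v ∈ T.supp x) : T.vdim v ≤ X.dim x := by
  have hK := T.mem_iff_of_flag T.knot_flag x
  have hS := T.mem_iff_of_flag T.surface_flag x
  change X.dim (T.pt v) ≤ X.dim x
  unfold KnotSurfaceTriple.dim
  by_cases h1 : x ∈ X.knot
  · rw [if_pos h1, if_pos (hK.1 h1 v h)]
  by_cases h2 : x ∈ X.surface
  · rw [if_neg h1, if_pos h2, if_pos (hS.1 h2 v h)]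
    split_ifs <;> simp
  · rw [if_neg h1, if_neg h2]
    split_ifs <;> simp

theorem exists_vdim_eq (x : M) : ∃ v ∈ T.supp x, T.vdim v = X.dim x := by
  have hK := T.mem_iff_of_flag T.knot_flag x
  have hS := T.mem_iff_of_flag T.surface_flag x
  obtain ⟨v₀, hv₀⟩ := (T.complex.isRelLowerSet_faces (T.supp_mem_faces x)).1
  change ∃ v ∈ T.supp x, X.dim (T.pt v) = X.dim x
  unfold KnotSurfaceTriple.dim
  by_cases h1 : x ∈ X.knot
  · exact ⟨v₀, hv₀, by rw [if_pos h1, if_pos (hK.1 h1 v₀ hv₀)]⟩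
  by_cases h2 : x ∈ X.surface
  · have h3 := h1
    rw [hK] at h3
    push Not at h3
    obtain ⟨v, hv, hvK⟩ := h3
    exact ⟨v, hv, by rw [if_neg h1, if_pos h2, if_neg hvK, if_pos (hS.1 h2 v hv)]⟩
  · have h3 := h2
    rw [hS] at h3
    push Not at h3
    obtain ⟨v, hv, hvS⟩ := h3
    exact ⟨v, hv, by rw [if_neg h1, if_neg h2, if_neg fun h => hvS (X.knot_subset h), if_neg hvS]⟩

/-- A vertex, in the stratum of a point, of the smallest simplex which contains this point. -/
def rep (x : M) : V := (T.exists_vdim_eq x).choose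

theorem rep_mem (x : M) : T.rep x ∈ T.supp x := (T.exists_vdim_eq x).choose_spec.1

theorem vdim_rep (x : M) : T.vdim (T.rep x) = X.dim x := (T.exists_vdim_eq x).choose_spec.2

theorem dim_pt_le_dim_pt {v w : V} (h : T.vdim v ≤ T.vdim w) : X.dim (T.pt v) ≤ X.dim (T.pt w) := h

theorem dim_pt_le {x : M} {v : V} (h : v ∈ T.supp x) : X.dim (T.pt v) ≤ X.dim x := T.vdim_le h

theorem dim_pt_rep (x : M) : X.dim (T.pt (T.rep x)) = X.dim x := T.vdim_rep x

/-! ### Straight lines -/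

/-- Two points are joinable if they lie in a common simplex. -/
def Joinable (x y : M) : Prop := ∃ s ∈ T.complex.faces, T.supp x ⊆ s ∧ T.supp y ⊆ s

variable {T}

theorem Joinable.symm {x y : M} (h : T.Joinable x y) : T.Joinable y x := by
  obtain ⟨s, hs, hx, hy⟩ := h
  exact ⟨s, hs, hy, hx⟩

theorem joinable_of_subset {x y : M} (h : T.supp x ⊆ T.supp y) : T.Joinable x y :=
  ⟨_, T.supp_mem_faces y, h, subset_rfl⟩

theorem joinable_pt_of_mem {x : M} {v : V} (h : v ∈ T.supp x) : T.Joinable (T.pt v) x :=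
  joinable_of_subset (by rw [supp_pt]; simpa using h)

theorem combo_mem {x y : M} (h : T.Joinable x y) (t : I) :
    (fun v => (1 - (t : ℝ)) * T.bary x v + t * T.bary y v) ∈ T.complex.realization := by
  obtain ⟨s, hs, hx, hy⟩ := h
  have h0 := t.2.1
  have h1 := t.2.2
  have hsum : ∑ v, ((1 - (t : ℝ)) * T.bary x v + t * T.bary y v) = 1 := by
    rw [Finset.sum_add_distrib, ← Finset.mul_sum, ← Finset.mul_sum, T.sum_bary, T.sum_bary]
    ring
  refine ⟨fun v => ?_, hsum, T.mem_faces_of_subset hs (fun v hv => ?_) ?_⟩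
  · have := T.bary_nonneg x v
    have := T.bary_nonneg y v
    have : 0 ≤ 1 - (t : ℝ) := by linarith
    positivity
  · rw [mem_support] at hv
    by_contra hvs
    have e1 : T.bary x v = 0 := not_not.1 fun h => hvs (hx (T.mem_supp.2 h))
    have e2 : T.bary y v = 0 := not_not.1 fun h => hvs (hy (T.mem_supp.2 h))
    exact hv (by rw [e1, e2]; ring)
  · by_contra hne
    rw [Finset.not_nonempty_iff_eq_empty] at hne
    rw [Finset.sum_eq_zero] at hsum
    · exact zero_ne_one hsum
    · intro v _
      by_contra hv
      exact Finset.notMem_empty v (hne ▸ mem_support.2 hv)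

/-- The point which divides the straight line from `x` to `y` in the ratio `t : 1 - t`. -/
def combo {x y : M} (h : T.Joinable x y) (t : I) : M := T.homeo ⟨_, combo_mem h t⟩

theorem bary_combo {x y : M} (h : T.Joinable x y) (t : I) (v : V) :
    T.bary (combo h t) v = (1 - (t : ℝ)) * T.bary x v + t * T.bary y v := by
  rw [bary, combo, Homeomorph.symm_apply_apply]

theorem bary_injective : Function.Injective T.bary :=
  Subtype.val_injective.comp T.homeo.symm.injective

theorem combo_zero {x y : M} (h : T.Joinable x y) : combo h 0 = x :=
  T.bary_injective (funext fun v => by simp [bary_combo])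

theorem combo_one {x y : M} (h : T.Joinable x y) : combo h 1 = y :=
  T.bary_injective (funext fun v => by simp [bary_combo])

theorem combo_self {x : M} (h : T.Joinable x x) (t : I) : combo h t = x :=
  T.bary_injective (funext fun v => by rw [bary_combo]; ring)

theorem combo_congr {x y y' : M} (h : T.Joinable x y) (h' : T.Joinable x y') (e : y = y') (t : I) :
    combo h t = combo h' t := by
  subst e
  rfl

theorem supp_combo_subset {x y : M} (h : T.Joinable x y) (t : I) {s : Finset V}
    (hx : T.supp x ⊆ s) (hy : T.supp y ⊆ s) : T.supp (combo h t) ⊆ s := by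
  intro v hv
  rw [mem_supp, bary_combo] at hv
  by_contra hvs
  have e1 : T.bary x v = 0 := not_not.1 fun h => hvs (hx (T.mem_supp.2 h))
  have e2 : T.bary y v = 0 := not_not.1 fun h => hvs (hy (T.mem_supp.2 h))
  exact hv (by rw [e1, e2]; ring)

theorem right_subset_supp_combo {x y : M} (h : T.Joinable x y) {t : I} (ht : t ≠ 0) :
    T.supp y ⊆ T.supp (combo h t) := by
  intro v hv
  rw [mem_supp] at hv ⊢
  rw [bary_combo]
  have h0 : (0 : ℝ) < t := unitInterval.pos_iff_ne_zero.2 ht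
  have h1 := t.2.2
  have h2 := T.bary_nonneg x v
  have h3 := (T.bary_nonneg y v).lt_of_ne' hv
  have : 0 ≤ 1 - (t : ℝ) := by linarith
  positivity

theorem left_subset_supp_combo {x y : M} (h : T.Joinable x y) {t : I} (ht : t ≠ 1) :
    T.supp x ⊆ T.supp (combo h t) := by
  intro v hv
  rw [mem_supp] at hv ⊢
  rw [bary_combo]
  have h0 := t.2.1
  have h1 : (t : ℝ) < 1 := unitInterval.lt_one_iff_ne_one.2 ht
  have h2 := T.bary_nonneg y v
  have h3 := (T.bary_nonneg x v).lt_of_ne' hv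
  have : 0 < 1 - (t : ℝ) := by linarith
  positivity

theorem mem_supp_combo {x y : M} (h : T.Joinable x y) (t : I) {v : V} (hx : v ∈ T.supp x)
    (hy : v ∈ T.supp y) : v ∈ T.supp (combo h t) := by
  by_cases ht : t = 0
  · rwa [ht, combo_zero]
  · exact right_subset_supp_combo h ht hy

theorem dim_combo {x y : M} (h : T.Joinable x y) (hd : X.dim x ≤ X.dim y) {t : I} (ht : t ≠ 0) :
    X.dim (combo h t) = X.dim y := by
  classical
  apply le_antisymm
  · obtain ⟨v, hv, e⟩ := T.exists_vdim_eq (combo h t)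
    rw [← e]
    rcases Finset.mem_union.1 (supp_combo_subset h t Finset.subset_union_left
      Finset.subset_union_right hv) with hv | hv
    · exact (T.vdim_le hv).trans hd
    · exact T.vdim_le hv
  · rw [← T.vdim_rep y]
    exact T.vdim_le (right_subset_supp_combo h ht (T.rep_mem y))

/-- The cone over a path. -/
def cone {x : M} {c : C(I, M)} (h : ∀ u, T.Joinable x (c u)) : C(I × I, M) where
  toFun z := combo (h z.2) z.1
  continuous_toFun := by
    refine T.homeo.continuous.comp (Continuous.subtype_mk ?_ _)
    refine continuous_pi fun v => ?_
    have hc : Continuous fun y => T.bary y v := (continuous_apply v).comp T.continuous_bary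
    fun_prop

theorem isDirectedSquare_cone {x : M} {c : C(I, M)} (h : ∀ u, T.Joinable x (c u))
    (hc : X.dSpace.IsDirected c) (hd : X.dim x ≤ X.dim (c 0)) :
    X.dSpace.IsDirectedSquare (cone h) := by
  have hd' : ∀ u, X.dim x ≤ X.dim (c u) := fun u => hd.trans (hc unitInterval.nonneg')
  intro γ hγ s t hst
  change X.dim (combo (h (γ s).2) (γ s).1) ≤ X.dim (combo (h (γ t).2) (γ t).1)
  obtain ⟨h1, h2⟩ := hγ hst
  by_cases hs : (γ s).1 = 0
  · rw [hs, combo_zero]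
    by_cases ht : (γ t).1 = 0
    · rw [ht, combo_zero]
    · rw [dim_combo _ (hd' _) ht]
      exact hd' _
  · have ht : (γ t).1 ≠ 0 := fun ht => hs (le_antisymm (ht ▸ h1) unitInterval.nonneg')
    rw [dim_combo _ (hd' _) hs, dim_combo _ (hd' _) ht]
    exact hc h2

/-- The straight line between two points. -/
def line {x y : M} (h : T.Joinable x y) (hd : X.dim x ≤ X.dim y) : X.dSpace.DPath x y :=
  ⟨⟨(cone (c := .const I y) fun _ => h).comp ⟨fun t => (t, 0), by fun_prop⟩,
    combo_zero h, combo_one h⟩,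
    isDirectedSquare_cone (c := .const I y) (fun _ => h) (X.dSpace.const y) hd
      ⟨fun t => (t, 0), by fun_prop⟩ fun _ _ h => ⟨h, le_rfl⟩⟩

/-- The class of a directed path, as an arrow of the fundamental category. -/
def homMk {x y : M} (p : X.dSpace.DPath x y) :
    (⟨x⟩ : X.dSpace.FundamentalCategory) ⟶ ⟨y⟩ := Quot.mk _ p

theorem homMk_trans {x y z : M} (p : X.dSpace.DPath x y) (q : X.dSpace.DPath y z) :
    homMk (p.trans q) = homMk p ≫ homMk q := rfl

theorem homMk_refl (x : M) : homMk (DSpace.DPath.refl X.dSpace x) = 𝟙 _ := rfl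

theorem homMk_line_comp {x y z : M} (h : T.Joinable x y) (hd : X.dim x ≤ X.dim y)
    (p : X.dSpace.DPath y z) (hp : ∀ u, T.Joinable x (p.1 u)) (h' : T.Joinable x z)
    (hd' : X.dim x ≤ X.dim z) :
    homMk (line h hd) ≫ homMk p = homMk (line h' hd') := by
  rw [← Category.id_comp (homMk (line h' hd')), ← homMk_refl, ← homMk_trans, ← homMk_trans]
  refine X.dSpace.mk_trans_eq_of_square (φ := cone (c := p.1.toContinuousMap) hp)
    (isDirectedSquare_cone (c := p.1.toContinuousMap) hp p.2 ?_) _ _ _ _ (fun u => ?_)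
    (fun u => ?_) (fun u => ?_) fun u => ?_
  · exact hd.trans (congrArg X.dim p.1.source).ge
  · exact combo_congr h (hp 0) p.1.source.symm u
  · exact (combo_one (hp u)).symm
  · exact (combo_zero (hp u)).symm
  · exact combo_congr h' (hp 1) p.1.target.symm u

theorem homMk_line_comp_line {x y z : M} {s : Finset V} (hs : s ∈ T.complex.faces)
    (hx : T.supp x ⊆ s) (hy : T.supp y ⊆ s) (hz : T.supp z ⊆ s) (hxy : T.Joinable x y)
    (hyz : T.Joinable y z) (hxz : T.Joinable x z) (dxy : X.dim x ≤ X.dim y)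
    (dyz : X.dim y ≤ X.dim z) (dxz : X.dim x ≤ X.dim z) :
    homMk (line hxy dxy) ≫ homMk (line hyz dyz) = homMk (line hxz dxz) :=
  homMk_line_comp hxy dxy (line hyz dyz)
    (fun u => ⟨s, hs, hx, supp_combo_subset hyz u hy hz⟩) hxz dxz

theorem homMk_line_self {x : M} (h : T.Joinable x x) (hd : X.dim x ≤ X.dim x) :
    homMk (line h hd) = 𝟙 _ := by
  rw [← homMk_refl]
  congr 1
  exact Subtype.ext (Path.ext (funext fun t => combo_self h t))

theorem rep_pt (v : V) : T.rep (T.pt v) = v := by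
  have := T.rep_mem (T.pt v)
  rwa [supp_pt, Finset.mem_singleton] at this

theorem supp_pt_subset {x : M} {v : V} (hv : v ∈ T.supp x) : T.supp (T.pt v) ⊆ T.supp x := by
  rwa [supp_pt, Finset.singleton_subset_iff]

theorem vdim_rep_pt (v : V) : T.vdim (T.rep (T.pt v)) = T.vdim v := by rw [rep_pt]

end FlagLikeTriangulation

namespace FlagLikeTriangulation

variable {M : Type*} [TopologicalSpace M] {X : KnotSurfaceTriple M} {V : Type*} [Fintype V]
  [DecidableEq V] (T : FlagLikeTriangulation X V)

/-! ### The category of a triangulation -/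

/-- A vertex, as an object of the category `C(T)`. -/
def catObj (v : V) : T.Cat := ⟨(⟨v⟩ : T.Graph)⟩

variable {T}

/-- The arrow of `C(T)` given by an edge. -/
def catGen {v w : V} (e : v ≠ w) (h : {v, w} ∈ T.complex.faces) (hd : T.vdim v ≤ T.vdim w) :
    T.catObj v ⟶ T.catObj w :=
  (CategoryTheory.Quotient.functor T.Rel).map ((Paths.of T.Graph).map
    (show (⟨v⟩ : T.Graph) ⟶ ⟨w⟩ from ⟨e, h, hd⟩))

/-- The arrow of `C(T)` between two vertices which are equal or joined by an edge. -/
def catEdge {v w : V} (h : {v, w} ∈ T.complex.faces) (hd : T.vdim v ≤ T.vdim w) :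
    T.catObj v ⟶ T.catObj w :=
  if e : v = w then eqToHom (congrArg T.catObj e) else catGen e h hd

theorem catEdge_self {v : V} (h : {v, v} ∈ T.complex.faces) (hd : T.vdim v ≤ T.vdim v) :
    catEdge h hd = 𝟙 (T.catObj v) := by
  rw [catEdge, dif_pos rfl, eqToHom_refl]

theorem catEdge_of_ne {v w : V} (e : v ≠ w) (h : {v, w} ∈ T.complex.faces)
    (hd : T.vdim v ≤ T.vdim w) : catEdge h hd = catGen e h hd :=
  dif_neg e

theorem catGen_comp_catGen_inv {v w : V} (e : v ≠ w) (h : {v, w} ∈ T.complex.faces)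
    (hd : T.vdim v ≤ T.vdim w) (e' : w ≠ v) (h' : {w, v} ∈ T.complex.faces)
    (hd' : T.vdim w ≤ T.vdim v) : catGen e h hd ≫ catGen e' h' hd' = 𝟙 (T.catObj v) :=
  CategoryTheory.Quotient.sound T.Rel (Rel.inv (v := ⟨v⟩) (w := ⟨w⟩) ⟨e, h, hd⟩ ⟨e', h', hd'⟩)

theorem catGen_comp_catGen {v w x : V} (h : {v, w, x} ∈ T.complex.faces) (evw : v ≠ w)
    (hvw : {v, w} ∈ T.complex.faces) (dvw : T.vdim v ≤ T.vdim w) (ewx : w ≠ x)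
    (hwx : {w, x} ∈ T.complex.faces) (dwx : T.vdim w ≤ T.vdim x) (evx : v ≠ x)
    (hvx : {v, x} ∈ T.complex.faces) (dvx : T.vdim v ≤ T.vdim x) :
    catGen evw hvw dvw ≫ catGen ewx hwx dwx = catGen evx hvx dvx :=
  CategoryTheory.Quotient.sound T.Rel (Rel.triangle (v := ⟨v⟩) (w := ⟨w⟩) (x := ⟨x⟩)
    ⟨evw, hvw, dvw⟩ ⟨ewx, hwx, dwx⟩ ⟨evx, hvx, dvx⟩ h)

/-- The arrows of `C(T)` are generated by the edges. -/
theorem cat_induction {P : ∀ {v w : V}, (T.catObj v ⟶ T.catObj w) → Prop}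
    (id : ∀ v, P (𝟙 (T.catObj v)))
    (comp : ∀ {u v w : V} (f : T.catObj u ⟶ T.catObj v) (h : {v, w} ∈ T.complex.faces)
      (hd : T.vdim v ≤ T.vdim w), P f → P (f ≫ catEdge h hd)) {v w : V}
    (f : T.catObj v ⟶ T.catObj w) : P f := by
  refine CategoryTheory.Quotient.induction T.Rel
    (P := fun {a b} (f : a ⟶ b) => P (v := a.as.vertex) (w := b.as.vertex) f) (fun f => ?_) f
  refine Paths.induction (fun {a b : Paths T.Graph} f => P (v := Graph.vertex (T := T) a)
    (w := Graph.vertex (T := T) b) ((CategoryTheory.Quotient.functor T.Rel).map f))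
    (fun {v} => ?_) (fun p q ih => ?_) f
  · exact id v.vertex
  · have := comp _ q.down.2.1 q.down.2.2 ih
    rw [catEdge_of_ne q.down.1] at this
    exact this

theorem catEdge_comp {v w x : V} (h : {v, w, x} ∈ T.complex.faces) (hvw : {v, w} ∈ T.complex.faces)
    (hwx : {w, x} ∈ T.complex.faces) (hvx : {v, x} ∈ T.complex.faces) (dvw : T.vdim v ≤ T.vdim w)
    (dwx : T.vdim w ≤ T.vdim x) (dvx : T.vdim v ≤ T.vdim x) :
    catEdge hvw dvw ≫ catEdge hwx dwx = catEdge hvx dvx := by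
  by_cases e1 : v = w
  · subst e1
    rw [catEdge_self, Category.id_comp]
  by_cases e2 : w = x
  · subst e2
    rw [catEdge_self, Category.comp_id]
  rw [catEdge_of_ne e1, catEdge_of_ne e2]
  by_cases e3 : v = x
  · subst e3
    rw [catEdge_self]
    exact catGen_comp_catGen_inv _ _ _ _ _ _
  · rw [catEdge_of_ne e3]
    exact catGen_comp_catGen h _ _ _ _ _ _ _ _ _

theorem pair_mem_faces {x : M} {v w : V} (hv : v ∈ T.supp x) (hw : w ∈ T.supp x) :
    {v, w} ∈ T.complex.faces :=
  T.mem_faces_of_subset (T.supp_mem_faces x) (by simp [Finset.insert_subset_iff, hv, hw]) (by simp)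

theorem catEdge_comp_of_mem {x : M} {u v w : V} (hu : u ∈ T.supp x) (hv : v ∈ T.supp x)
    (hw : w ∈ T.supp x) (huv : {u, v} ∈ T.complex.faces) (hvw : {v, w} ∈ T.complex.faces)
    (huw : {u, w} ∈ T.complex.faces) (duv : T.vdim u ≤ T.vdim v) (dvw : T.vdim v ≤ T.vdim w)
    (duw : T.vdim u ≤ T.vdim w) : catEdge huv duv ≫ catEdge hvw dvw = catEdge huw duw :=
  catEdge_comp (T.mem_faces_of_subset (T.supp_mem_faces x)
    (by simp [Finset.insert_subset_iff, hu, hv, hw]) (by simp)) _ _ _ _ _ _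

theorem isIso_catEdge {v w : V} (h : {v, w} ∈ T.complex.faces) (hd : T.vdim v ≤ T.vdim w)
    (hd' : T.vdim w ≤ T.vdim v) : IsIso (catEdge h hd) := by
  have h' : {w, v} ∈ T.complex.faces := by rwa [Finset.pair_comm]
  have hv : {v, v} ∈ T.complex.faces := T.mem_faces_of_subset h (by simp) (by simp)
  have hw : {w, w} ∈ T.complex.faces := T.mem_faces_of_subset h (by simp) (by simp)
  refine ⟨catEdge h' hd', ?_, ?_⟩
  · rw [catEdge_comp (by simpa using h') h h' hv hd hd' le_rfl, catEdge_self]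
  · rw [catEdge_comp (by simpa using h) h' h hw hd' hd le_rfl, catEdge_self]

variable (T) in
/-- Transport with values in the category `C(T)`: the object at a point is a vertex of its smallest
simplex in the same stratum. -/
def transportSystem : TransportSystem X.dim T.Cat where
  obj x := T.catObj (T.rep x)
  Adj x y := T.rep x ∈ T.supp y
  sp {x y} h := catEdge (pair_mem_faces h (T.rep_mem y))
    (by rw [T.vdim_rep y]; exact T.vdim_le h)
  eventually_adj x := T.eventually_mem_supp (T.rep_mem x)
  le {x y} h := by rw [← T.vdim_rep x]; exact T.vdim_le h
  sp_self _ := catEdge_self _ _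
  sp_comp {x y z} _ h' h'' := catEdge_comp_of_mem h'' h' (T.rep_mem z) _ _ _ _ _ _
  isIso_sp {x y} _ e := isIso_catEdge _ _ (by rw [T.vdim_rep, T.vdim_rep, e])

variable (T)

/-- The functor from the fundamental category to the category of a triangulation. -/
def toCat : X.dSpace.FundamentalCategory ⥤ T.Cat := T.transportSystem.functor

/-- The action of `toCat` on arrows. -/
def toCatMap {x y : M} (f : (⟨x⟩ : X.dSpace.FundamentalCategory) ⟶ ⟨y⟩) :
    T.catObj (T.rep x) ⟶ T.catObj (T.rep y) := T.toCat.map f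

theorem toCatMap_comp {x y z : M} (f : (⟨x⟩ : X.dSpace.FundamentalCategory) ⟶ ⟨y⟩)
    (g : (⟨y⟩ : X.dSpace.FundamentalCategory) ⟶ ⟨z⟩) :
    T.toCatMap (f ≫ g) = T.toCatMap f ≫ T.toCatMap g := T.toCat.map_comp f g

theorem toCatMap_id (x : M) :
    T.toCatMap (𝟙 (⟨x⟩ : X.dSpace.FundamentalCategory)) = 𝟙 (T.catObj (T.rep x)) :=
  T.toCat.map_id ⟨x⟩

variable {T}

theorem catEdge_comp_toCatMap {x y z : M} (p : X.dSpace.DPath x y)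
    (h : ∀ t, T.rep z ∈ T.supp (p.1 t)) (hx : {T.rep z, T.rep x} ∈ T.complex.faces)
    (hy : {T.rep z, T.rep y} ∈ T.complex.faces) (dx : T.vdim (T.rep z) ≤ T.vdim (T.rep x))
    (dy : T.vdim (T.rep z) ≤ T.vdim (T.rep y)) :
    catEdge hx dx ≫ T.toCatMap (homMk p) = catEdge hy dy :=
  T.transportSystem.sp_comp_pathMap p h (by have := h 0; rwa [p.1.source] at this)
    (by have := h 1; rwa [p.1.target] at this)

theorem toCatMap_line {x y : M} (h : T.Joinable x y) (hd : X.dim x ≤ X.dim y)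
    (hf : {T.rep x, T.rep y} ∈ T.complex.faces) (hd' : T.vdim (T.rep x) ≤ T.vdim (T.rep y)) :
    T.toCatMap (homMk (line h hd)) = catEdge hf hd' := by
  have half0 : unitInterval.half ≠ 0 := fun e => by
    have := congrArg Subtype.val e
    norm_num [unitInterval.coe_half] at this
  have half1 : unitInterval.half ≠ 1 := fun e => by
    have := congrArg Subtype.val e
    norm_num [unitInterval.coe_half] at this
  set m := combo h unitInterval.half with hm
  have dm : X.dim m = X.dim y := dim_combo h hd half0
  have sx : T.supp x ⊆ T.supp m := left_subset_supp_combo h half1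
  have sy : T.supp y ⊆ T.supp m := right_subset_supp_combo h half0
  have dxm : X.dim x ≤ X.dim m := hd.trans dm.ge
  have jxm : T.Joinable x m := joinable_of_subset sx
  have jmy : T.Joinable m y := (joinable_of_subset sy).symm
  rw [← homMk_line_comp_line (T.supp_mem_faces m) sx subset_rfl sy jxm jmy h dxm dm.le hd,
    toCatMap_comp]
  have hx := T.rep_mem x
  have hy := T.rep_mem y
  have hr := T.rep_mem m
  have d1 : T.vdim (T.rep x) ≤ T.vdim (T.rep m) := by rwa [T.vdim_rep, T.vdim_rep]
  have d2 : T.vdim (T.rep y) ≤ T.vdim (T.rep m) := by rw [T.vdim_rep, T.vdim_rep, dm]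
  have d3 : T.vdim (T.rep m) ≤ T.vdim (T.rep y) := by rw [T.vdim_rep, T.vdim_rep, dm]
  have f1 := pair_mem_faces (sx hx) hr
  have f2 := pair_mem_faces (sy hy) hr
  have f3 := pair_mem_faces hr (sy hy)
  have f4 := pair_mem_faces hy hy
  have f5 := pair_mem_faces hx hx
  have e1 := catEdge_comp_toCatMap (T := T) (line jxm dxm) (z := x)
    (fun t => mem_supp_combo jxm t hx (sx hx)) f5 f1 le_rfl d1
  have e2 := catEdge_comp_toCatMap (T := T) (line jmy dm.le) (z := y)
    (fun t => mem_supp_combo jmy t (sy hy) hy) f2 f4 d2 le_rfl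
  rw [catEdge_self, Category.id_comp] at e1
  have := isIso_catEdge f2 d2 d3
  have e3 := catEdge_comp_of_mem (sy hy) hr (sy hy) f2 f3 f4 d2 d3 le_rfl
  rw [e1, (cancel_epi _).1 (e2.trans e3.symm)]
  exact catEdge_comp_of_mem (sx hx) hr (sy hy) _ _ _ _ _ _

theorem joinable_pt {v w : V} (h : {v, w} ∈ T.complex.faces) : T.Joinable (T.pt v) (T.pt w) :=
  ⟨_, h, by simp [supp_pt], by simp [supp_pt]⟩

variable (T)

/-- The edges of a triangulation, as directed paths. -/
def edgePrefunctor : T.Graph ⥤q X.dSpace.FundamentalCategory where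
  obj v := ⟨T.pt v.vertex⟩
  map e := homMk (line (joinable_pt e.down.2.1) (T.dim_pt_le_dim_pt e.down.2.2))

/-- The functor from the category of a triangulation to the fundamental category, which sends edges
to straight lines. -/
def ofCat : T.Cat ⥤ X.dSpace.FundamentalCategory :=
  CategoryTheory.Quotient.lift T.Rel (Paths.lift T.edgePrefunctor) (by
    intro v w f g h
    induction h with
    | @inv v w e f =>
      refine (CategoryTheory.Functor.map_comp _ _ _).trans ?_
      refine (congrArg₂ (· ≫ ·) (Paths.lift_toPath T.edgePrefunctor e)
        (Paths.lift_toPath T.edgePrefunctor f)).trans ?_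
      refine Eq.trans ?_ (CategoryTheory.Functor.map_id _ _).symm
      refine (homMk_line_comp_line e.down.2.1 (by simp [supp_pt]) (by simp [supp_pt])
        (by simp [supp_pt]) _ _ (joinable_of_subset subset_rfl) _ _ le_rfl).trans ?_
      exact homMk_line_self _ _
    | @triangle v w x e f g h =>
      refine (CategoryTheory.Functor.map_comp _ _ _).trans ?_
      refine (congrArg₂ (· ≫ ·) (Paths.lift_toPath T.edgePrefunctor e)
        (Paths.lift_toPath T.edgePrefunctor f)).trans ?_
      refine Eq.trans ?_ (Paths.lift_toPath T.edgePrefunctor g).symm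
      exact homMk_line_comp_line h (by simp [supp_pt]) (by simp [supp_pt])
        (by simp [supp_pt]) _ _ _ _ _ _)

/-- The action of `ofCat` on arrows. -/
def ofCatMap {v w : V} (f : T.catObj v ⟶ T.catObj w) :
    (⟨T.pt v⟩ : X.dSpace.FundamentalCategory) ⟶ ⟨T.pt w⟩ := T.ofCat.map f

theorem ofCatMap_id (v : V) :
    T.ofCatMap (𝟙 (T.catObj v)) = 𝟙 (⟨T.pt v⟩ : X.dSpace.FundamentalCategory) :=
  T.ofCat.map_id (T.catObj v)

theorem ofCatMap_comp {u v w : V} (f : T.catObj u ⟶ T.catObj v) (g : T.catObj v ⟶ T.catObj w) :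
    T.ofCatMap (f ≫ g) = T.ofCatMap f ≫ T.ofCatMap g :=
  T.ofCat.map_comp f g

variable {T}

theorem ofCatMap_catEdge {v w : V} (h : {v, w} ∈ T.complex.faces) (hd : T.vdim v ≤ T.vdim w) :
    T.ofCatMap (catEdge h hd) = homMk (line (joinable_pt h) (T.dim_pt_le_dim_pt hd)) := by
  by_cases e : v = w
  · subst e
    rw [catEdge_self, ofCatMap_id]
    exact (homMk_line_self _ _).symm
  · rw [catEdge_of_ne e]
    exact Paths.lift_toPath T.edgePrefunctor (X := ⟨v⟩) (Y := ⟨w⟩) ⟨e, h, hd⟩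

theorem face_rep_pt (v : V) : {T.rep (T.pt v), v} ∈ T.complex.faces := by
  rw [rep_pt]
  simpa using T.complex.singleton_mem v

variable (T) in
/-- The vertex `v` and the vertex which is associated to the point `v` are isomorphic. -/
def repIso (v : V) : T.catObj (T.rep (T.pt v)) ≅ T.catObj v :=
  have := isIso_catEdge (T := T) (face_rep_pt v) (vdim_rep_pt v).le (vdim_rep_pt v).ge
  asIso (catEdge (T := T) (face_rep_pt v) (vdim_rep_pt v).le)

theorem repIso_hom (v : V) : (T.repIso v).hom = catEdge (face_rep_pt v) (vdim_rep_pt v).le := rfl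

theorem toCatMap_ofCatMap {v w : V} (f : T.catObj v ⟶ T.catObj w) :
    T.toCatMap (T.ofCatMap f) ≫ (T.repIso w).hom = (T.repIso v).hom ≫ f := by
  refine cat_induction (P := fun {v w} f =>
    T.toCatMap (T.ofCatMap f) ≫ (T.repIso w).hom = (T.repIso v).hom ≫ f) (fun v => ?_) ?_ f
  · rw [ofCatMap_id, toCatMap_id, Category.id_comp, Category.comp_id]
  · intro u v w f h hd ih
    rw [ofCatMap_comp, toCatMap_comp, Category.assoc, ← Category.assoc _ f, ← ih, Category.assoc]
    congr 1
    have hf : {T.rep (T.pt v), T.rep (T.pt w)} ∈ T.complex.faces := by rwa [rep_pt, rep_pt]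
    have hd' : T.vdim (T.rep (T.pt v)) ≤ T.vdim (T.rep (T.pt w)) := by rwa [rep_pt, rep_pt]
    have hq : {T.rep (T.pt v), w} ∈ T.complex.faces := by rwa [rep_pt]
    have hqd : T.vdim (T.rep (T.pt v)) ≤ T.vdim w := by rwa [rep_pt]
    rw [ofCatMap_catEdge, toCatMap_line _ _ hf hd', repIso_hom, repIso_hom,
      catEdge_comp (by simpa [rep_pt] using h) hf (face_rep_pt _) hq hd' (vdim_rep_pt _).le hqd,
      catEdge_comp (by simpa [rep_pt] using h) (face_rep_pt _) h hq (vdim_rep_pt _).le hd hqd]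

/-! ### Straight lines from representative vertices -/

variable (T) in
/-- The straight line from the representative vertex of a point to this point. -/
def repLine (x : M) : (⟨T.pt (T.rep x)⟩ : X.dSpace.FundamentalCategory) ⟶ ⟨x⟩ :=
  homMk (line (joinable_pt_of_mem (T.rep_mem x)) (T.dim_pt_rep x).le)

instance (x : M) : IsIso (T.repLine x) := by
  have hs := supp_pt_subset (T.rep_mem x)
  have j := joinable_of_subset hs
  refine ⟨homMk (line j.symm (T.dim_pt_rep x).ge), ?_, ?_⟩
  · refine (homMk_line_comp_line (T.supp_mem_faces x) hs subset_rfl hs _ _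
      (joinable_of_subset subset_rfl) _ _ le_rfl).trans ?_
    exact homMk_line_self _ _
  · refine (homMk_line_comp_line (T.supp_mem_faces x) subset_rfl hs subset_rfl _ _
      (joinable_of_subset subset_rfl) _ _ le_rfl).trans ?_
    exact homMk_line_self _ _

theorem ofCatMap_comp_repLine {x : M} {v : V} (hv : v ∈ T.supp x)
    (hf : {v, T.rep x} ∈ T.complex.faces) (hd : T.vdim v ≤ T.vdim (T.rep x)) :
    T.ofCatMap (catEdge hf hd) ≫ T.repLine x =
      homMk (line (joinable_pt_of_mem hv) (T.dim_pt_le hv)) := by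
  rw [ofCatMap_catEdge]
  exact homMk_line_comp_line (T.supp_mem_faces x) (supp_pt_subset hv)
    (supp_pt_subset (T.rep_mem x)) subset_rfl _ _ _ _ _ _

theorem repLine_comp_segment {c : C(I, M)} (hc : X.dSpace.IsDirected c) {a b : I} (hab : a ≤ b) :
    T.repLine (c a) ≫ homMk (X.dSpace.segment hc hab) =
      T.ofCatMap (T.toCatMap (homMk (X.dSpace.segment hc hab))) ≫ T.repLine (c b) := by
  refine rel_of_eventually_rel (R := fun s t => ∀ h : s ≤ t,
    T.repLine (c s) ≫ homMk (X.dSpace.segment hc h) =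
      T.ofCatMap (T.toCatMap (homMk (X.dSpace.segment hc h))) ≫ T.repLine (c t))
    hab ?_ (fun t _ => ?_) _
  · intro s t u _ hst htu _ h1 h2 hsu
    have e : homMk (X.dSpace.segment hc hsu) =
        homMk (X.dSpace.segment hc hst) ≫ homMk (X.dSpace.segment hc htu) :=
      (X.dSpace.mk_segment_trans hc hst htu).symm
    rw [e, toCatMap_comp, ofCatMap_comp, Category.assoc, ← h2 htu, ← Category.assoc, h1 hst,
      Category.assoc]
  refine Filter.Eventually.filter_mono nhdsWithin_le_nhds ?_
  filter_upwards [eventually_forall_uIcc (c.continuous.continuousAt.eventually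
    (T.eventually_mem_supp (T.rep_mem (c t))))] with s hs
  have hct := hs t Set.left_mem_uIcc
  have hcs := hs s Set.right_mem_uIcc
  have mem_seg : ∀ {u v : I} (h : u ≤ v) (r : I),
      unitInterval.affinePath u v r ∈ Set.Icc u v := fun {u v} h r => by
    have m := unitInterval.affinePath_monotone h
    constructor
    · simpa using m (unitInterval.nonneg' (t := r))
    · simpa using m (unitInterval.le_one' (t := r))
  have df := pair_mem_faces hcs (T.rep_mem (c s))
  have dd : T.vdim (T.rep (c t)) ≤ T.vdim (T.rep (c s)) := by
    rw [T.vdim_rep (c s)]; exact T.vdim_le hcs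
  have key := ofCatMap_comp_repLine hcs df dd
  have ft := pair_mem_faces hct hct
  constructor
  · intro hst _
    rw [Set.uIcc_of_ge hst] at hs
    have hp : ∀ r, T.rep (c t) ∈ T.supp ((X.dSpace.segment hc hst).1 r) :=
      fun r => hs _ (mem_seg hst r)
    have dd' : T.vdim (T.rep (c s)) ≤ T.vdim (T.rep (c t)) := by
      rw [T.vdim_rep, T.vdim_rep]; exact hc hst
    have e := catEdge_comp_toCatMap (X.dSpace.segment hc hst) hp df ft dd le_rfl
    have hiso : IsIso (T.ofCatMap (catEdge df dd)) :=
      have := isIso_catEdge df dd dd'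
      inferInstanceAs (IsIso (T.ofCat.map (catEdge df dd)))
    rw [← cancel_epi (T.ofCatMap (catEdge df dd)), ← Category.assoc, key, ← Category.assoc,
      ← ofCatMap_comp, e, catEdge_self, ofCatMap_id, Category.id_comp]
    exact homMk_line_comp _ _ _ (fun r => joinable_pt_of_mem (hp r)) _ _
  · intro hts _
    rw [Set.uIcc_of_le hts] at hs
    have hp : ∀ r, T.rep (c t) ∈ T.supp ((X.dSpace.segment hc hts).1 r) :=
      fun r => hs _ (mem_seg hts r)
    have e := catEdge_comp_toCatMap (X.dSpace.segment hc hts) hp ft df le_rfl dd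
    rw [catEdge_self, Category.id_comp] at e
    rw [e, key]
    exact homMk_line_comp _ _ _ (fun r => joinable_pt_of_mem (hp r)) _ _

/-- A directed path is, up to homotopy, determined by transport along it. -/
theorem repLine_comp_homMk {x y : M} (p : X.dSpace.DPath x y) :
    T.repLine x ≫ homMk p = T.ofCatMap (T.toCatMap (homMk p)) ≫ T.repLine y := by
  obtain ⟨⟨c, rfl, rfl⟩, hc⟩ := p
  have hseg : (⟨⟨c, rfl, rfl⟩, hc⟩ : X.dSpace.DPath (c 0) (c 1)) =
      X.dSpace.segment hc unitInterval.nonneg' :=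
    Subtype.ext (Path.ext (funext fun t => congrArg c (Subtype.ext (by
      simp [unitInterval.affinePath_apply]))))
  have := repLine_comp_segment (T := T) hc (unitInterval.nonneg' (t := 1))
  rw [← hseg] at this
  exact this

theorem repLine_comp {x y : M} (f : (⟨x⟩ : X.dSpace.FundamentalCategory) ⟶ ⟨y⟩) :
    T.repLine x ≫ f = T.ofCatMap (T.toCatMap f) ≫ T.repLine y := by
  obtain ⟨p, rfl⟩ := Quot.exists_rep f
  exact repLine_comp_homMk p

instance : T.toCat.Faithful where
  map_injective {x y f g} h := by
    have e1 := repLine_comp (T := T) f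
    have e2 := repLine_comp (T := T) g
    rw [show T.toCatMap f = T.toCatMap g from h, ← e2] at e1
    exact (cancel_epi _).1 e1

theorem toCatMap_repLine (x : M) : T.toCatMap (T.repLine x) = (T.repIso (T.rep x)).hom :=
  toCatMap_line (T := T) _ _ (face_rep_pt _) (vdim_rep_pt _).le

theorem toCatMap_surjective {x y : M} (f : T.catObj (T.rep x) ⟶ T.catObj (T.rep y)) :
    ∃ g, T.toCatMap (x := x) (y := y) g = f := by
  refine ⟨inv (T.repLine x) ≫ T.ofCatMap f ≫ T.repLine y, ?_⟩
  rw [← cancel_epi (T.repIso (T.rep x)).hom, ← toCatMap_ofCatMap f, ← toCatMap_repLine,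
    ← toCatMap_repLine, ← toCatMap_comp, IsIso.hom_inv_id_assoc, toCatMap_comp]

instance : T.toCat.Full where
  map_surjective f := toCatMap_surjective f

instance : T.toCat.EssSurj where
  mem_essImage a := ⟨⟨T.pt a.as.vertex⟩, ⟨T.repIso a.as.vertex⟩⟩

instance : T.toCat.IsEquivalence where

variable (T) in
theorem toCat_comp_toThree : T.toCat ⋙ T.toThree = X.dimFunctor :=
  CategoryTheory.Functor.ext (fun x => T.vdim_rep x.pt) fun _ _ _ => Subsingleton.elim _ _

/-! ### Finiteness -/

variable (T) in
/-- The objects of `C(T)` are the vertices. -/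
def catEquiv : T.Cat ≃ V where
  toFun a := a.as.vertex
  invFun := T.catObj
  left_inv _ := rfl
  right_inv _ := rfl

instance : Finite T.Cat := .of_equiv _ T.catEquiv.symm

theorem vertexCount_eq (i : Three) : T.vertexCount i = Nat.card {a : T.Cat // T.toThree.obj a = i} :=
  Nat.card_congr (T.catEquiv.subtypeEquiv fun _ => Iff.rfl).symm

instance {C : Type*} [Category C] [∀ a b : C, Finite (a ⟶ b)] (c : T.Cat → C) :
    Finite (FunctorOn c) := by
  have hinj : Function.Injective fun (F : FunctorOn c) (v w : V)
      (h : v ≠ w ∧ {v, w} ∈ T.complex.faces ∧ T.vdim v ≤ T.vdim w) =>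
      F.map (catEdge h.2.1 h.2.2) := by
    intro F F' h
    refine FunctorOn.ext ?_
    funext a b f
    refine cat_induction (P := fun {v w} (f : T.catObj v ⟶ T.catObj w) => F.map f = F'.map f)
      (fun v => by rw [F.map_id, F'.map_id]) (fun {u v w} f hf hd ih => ?_) f
    rw [F.map_comp, F'.map_comp, ih]
    congr 1
    by_cases e : v = w
    · subst e
      rw [catEdge_self, F.map_id, F'.map_id]
    · exact congrFun (congrFun (congrFun h v) w) ⟨e, hf, hd⟩
  exact .of_injective _ hinj

end FlagLikeTriangulation

end

theorem mainTheorem5 {M : Type*} [TopologicalSpace M] [T2Space M] [CompactSpace M]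
    (X : KnotSurfaceTriple M) :
    ∃ D : X.dSpace.FundamentalCategory ⥤ Three,
      (∀ x, D.obj x = X.dim x.pt) ∧
      ∀ {V : Type*} [Fintype V] [DecidableEq V] (T : FlagLikeTriangulation X V)
        {C : Type*} [Category C] [∀ a b : C, Finite (a ⟶ b)] (𝒞 : Parcel Three C)
        {S : Type*} [Category S] (ι : S ⥤ X.dSpace.FundamentalCategory),
        IsSkeletonOf X.dSpace.FundamentalCategory S ι →
          Finite S ∧ Finite {F : S ⥤ C // F ⋙ 𝒞.U = ι ⋙ D} ∧
          T.stateSum 𝒞 = (Nat.card {F : S ⥤ C // F ⋙ 𝒞.U = ι ⋙ D} : ℚ) /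
            ∏ i : Three, (𝒞.groupOrder i : ℚ) ^ Nat.card {s : S // D.obj (ι.obj s) = i} := by
  refine ⟨X.dimFunctor, fun _ => rfl, ?_⟩
  intro V _ _ T C _ _ 𝒞 S _ ι hι
  have := hι.eqv
  have hS : Finite S := .of_injective (ι ⋙ T.toCat).obj fun s t h =>
    hι.skel ⟨(ι ⋙ T.toCat).preimageIso (eqToIso h)⟩
  have hA : Finite {F : T.Cat ⥤ C // F ⋙ 𝒞.U = T.toThree} :=
    .of_equiv _ (𝒞.overEquiv T.toThree).symm
  rw [← T.toCat_comp_toThree]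
  refine ⟨hS, 𝒞.finite_over_of_isEquivalence (ι ⋙ T.toCat) T.toThree, ?_⟩
  have key := 𝒞.card_over_mul_of_isEquivalence (ι ⋙ T.toCat) T.toThree
  have pos : ∀ i, (𝒞.groupOrder i : ℚ) ≠ 0 := fun i =>
    Nat.cast_ne_zero.2 (𝒞.groupOrder_pos i).ne'
  rw [FlagLikeTriangulation.stateSum, div_eq_div_iff
    (Finset.prod_ne_zero_iff.2 fun i _ => pow_ne_zero _ (pos i))
    (Finset.prod_ne_zero_iff.2 fun i _ => pow_ne_zero _ (pos i))]
  simp only [FlagLikeTriangulation.vertexCount_eq]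
  exact_mod_cast key.symm
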